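/- \textbf{Conventions.} Let $n\ge 1$. Functions are real- or complex-valued and Lebesgue measurable, and are identified if they agree almost everywhere. A \emph{ball Banach function space} $X(\mathbb{R}^n)$ is the space of all measurable $f$ on $\mathbb{R}^n$ with $\|f\|_{X(\mathbb{R}^n)}<\infty$, where $\|\cdot\|_{X(\mathbb{R}^n)}$ is a $[0,\infty]$-valued functional defined for all measurable functions, is a norm where it is finite (in particular it satisfies the triangle inequality and is absolutely homogeneous), vanishes only at functions that are $0$ a.e., and satisfies: $|g|\le|f|$ a.e. implies $\|g\|_{X(\mathbb{R}^n)}\le\|f\|_{X(\mathbb{R}^n)}$; $0\le f_m\uparrow f$ a.e. implies $\|f_m\|_{X(\mathbb{R}^n)}\uparrow\|f\|_{X(\mathbb{R}^n)}$; for every ball $B$, $\mathbf 1_B\in X(\mathbb{R}^n)$ and there is $C_{(B)}>0$ with $\int_B|f|\,dx\le C_{(B)}\|f\|_{X(\mathbb{R}^n)}$ for all $f\in X(\mathbb{R}^n)$. The norm of a measurable $[0,\infty]$-valued function that is infinite on a set of positive measure is $\infty$. The \emph{associate space} $X'(\mathbb{R}^n)$ is given by the norm $\|f\|_{X'(\mathbb{R}^n)}:=\sup\{\int_{\mathbb{R}^n}|fg|\,dx:\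 \|g\|_{X(\mathbb{R}^n)}=1\}$. For $Y\in\{X,X'\}$ and an open set $\Omega\subset\mathbb{R}^n$, $Y(\Omega)$ is the space of restrictions to $\Omega$ of functions in $Y(\mathbb{R}^n)$, with $\|f\|_{Y(\Omega)}:=\inf\{\|g\|_{Y(\mathbb{R}^n)}:\ g|_\Omega=f\}$. $Y(\Omega)$ has an \emph{absolutely continuous norm} if $\|f\mathbf 1_{E_j}\|_{Y(\Omega)}\to0$ for every $f\in Y(\Omega)$ and all measurable $E_j\subset\Omega$ with $\mathbf 1_{E_j}\to0$ a.e. in $\Omega$. $X'(\mathbb{R}^n)$ is \emph{locally $\beta$-doubling} if there is $C>0$ such that $\|\mathbf 1_{B(\mathbf 0,\lambda r)}\|_{X'(\mathbb{R}^n)}\le C\lambda^\beta\|\mathbf 1_{B(\mathbf 0,r)}\|_{X'(\mathbb{R}^n)}$ for all $r\in(0,\infty)$ and $\lambda\in[1,\infty)$. For $\nu_0\in(0,\infty)$, a \emph{$\nu_0$-radial decreasing approximation of the identity} is a family $\{\rho_\nu\}_{\nu\in(0,\nu_0)}$ of nonnegative, locally integrable, nonincreasing functions on $(0,\infty)$ with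 $\int_0^\infty\rho_\nu(r)r^{n-1}\,dr=1$ for every $\nu\in(0,\nu_0)$ and $\lim_{\nu\to0^+}\int_\delta^\infty\rho_\nu(r)r^{n-1}\,dr=0$ for every $\delta\in(0,\infty)$. \textbf{Theorem.} Let $X(\mathbb{R}^n)$ be a ball Banach function space, $\Omega\subset\mathbb{R}^n$ an open set, $\{\rho_\nu\}_{\nu\in(0,\nu_0)}$ a $\nu_0$-radial decreasing approximation of the identity with $\nu_0\in(0,\infty)$, and $p\in[1,\infty)$. Assume that (i) $C_{\mathrm c}^\infty(\Omega)$ is dense in $X'(\Omega)$; (ii) $X'(\Omega)$ has an absolutely continuous norm; (iii) $X'(\mathbb{R}^n)$ is locally $\beta$-doubling for some $\beta\in(0,n+1)$. Then there is a constant $C\in(0,\infty)$ such that every $f\in X(\Omega)$ with $$\Lambda(f):=\liminf_{\nu\to0^+}\left\|\left[\int_\Omega\frac{|f(\cdot)-f(y)|^p}{|\cdot-y|^p}\,\rho_\nu(|\cdot-y|)\,dy\right]^{1/p}\right\|_{X(\Omega)}<\infty$$ has a weak gradient $\nabla f\in L^1_{\mathrm{loc}}(\Omega)$ satisfying $|\nabla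 f|\in X(\Omega)$ and $$\big\|\,|\nabla f|\,\big\|_{X(\Omega)}\le C\,\Lambda(f).$$ The constant $C$ does not depend on $f$. -/

import Mathlib

open MeasureTheory Filter Set
open scoped ENNReal NNReal Topology

noncomputable section

namespace BallBanach

/-- Euclidean space `ℝⁿ` with its Euclidean norm and Lebesgue measure. -/
abbrev Eucl (n : ℕ) : Type := EuclideanSpace ℝ (Fin n)

/-- A functional on `[0,∞]`-valued functions on `ℝⁿ`. The norm of a real or complex function `f` is
the value of the functional at `|f|`; only values at Lebesgue measurable
(that is, a.e.-measurable) functions matter. -/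
abbrev FunctionNorm (n : ℕ) : Type := (Eucl n → ℝ≥0∞) → ℝ≥0∞

/-- `N` is the norm of a ball Banach function space `X(ℝⁿ) = {f measurable : N |f| < ∞}`.
Completeness of `X(ℝⁿ)` is a consequence of these axioms. -/
structure IsBallBanachNorm {n : ℕ} (N : FunctionNorm n) : Prop where
  smul : ∀ (c : ℝ≥0) (f : Eucl n → ℝ≥0∞), AEMeasurable f volume →
    N (fun x => (c : ℝ≥0∞) * f x) = c * N f
  ae_zero : ∀ f : Eucl n → ℝ≥0∞, AEMeasurable f volume → N f = 0 → f =ᵐ[volume] 0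
  mono : ∀ f g : Eucl n → ℝ≥0∞, AEMeasurable f volume → AEMeasurable g volume →
    g ≤ᵐ[volume] f → N g ≤ N f
  fatou : ∀ (f : ℕ → Eucl n → ℝ≥0∞) (g : Eucl n → ℝ≥0∞),
    (∀ m, AEMeasurable (f m) volume) → AEMeasurable g volume →
    (∀ᵐ x ∂volume, Monotone (fun m => f m x) ∧ Tendsto (fun m => f m x) atTop (𝓝 (g x))) →
    Tendsto (fun m => N (f m)) atTop (𝓝 (N g))
  ball_mem : ∀ (x : Eucl n) (r : ℝ), 0 < r → N ((Metric.ball x r).indicator 1) < ∞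
  add : ∀ f g : Eucl n → ℝ≥0∞, AEMeasurable f volume → AEMeasurable g volume →
    N f < ∞ → N g < ∞ → N (f + g) ≤ N f + N g
  integral_ball : ∀ (x : Eucl n) (r : ℝ), 0 < r → ∃ C : ℝ≥0, 0 < C ∧
    ∀ f : Eucl n → ℝ≥0∞, AEMeasurable f volume → N f < ∞ →
      ∫⁻ y in Metric.ball x r, f y ≤ C * N f

/-- The norm of the associate space (Köthe dual) `X'(ℝⁿ)`. -/
def associate {n : ℕ} (N : FunctionNorm n) : FunctionNorm n := fun f =>
  ⨆ (g : Eucl n → ℝ≥0∞) (_ : AEMeasurable g volume) (_ : N g = 1), ∫⁻ x, f x * g x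

/-- The norm of the restrictive space `X(Ω)`: the infimum of the norms of all measurable
extensions to `ℝⁿ` of the restriction of `h` to `Ω`. -/
def normOn {n : ℕ} (N : FunctionNorm n) (Ω : Set (Eucl n)) (h : Eucl n → ℝ≥0∞) : ℝ≥0∞ :=
  ⨅ (g : Eucl n → ℝ≥0∞) (_ : AEMeasurable g volume) (_ : g =ᵐ[volume.restrict Ω] h), N g

/-- `f ∈ X(Ω)`; only the values of `f` on `Ω` matter. -/
def MemOn {n : ℕ} {𝕜 : Type*} [RCLike 𝕜] (N : FunctionNorm n) (Ω : Set (Eucl n))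
    (f : Eucl n → 𝕜) : Prop :=
  AEStronglyMeasurable f (volume.restrict Ω) ∧ normOn N Ω (fun x => ‖f x‖ₑ) < ∞

/-- `φ ∈ C_c^∞(Ω)`. -/
structure IsTest {n : ℕ} {𝕜 : Type*} [RCLike 𝕜] (Ω : Set (Eucl n)) (φ : Eucl n → 𝕜) : Prop where
  smooth : ContDiff ℝ (⊤ : ℕ∞) φ
  compact : HasCompactSupport φ
  subset : tsupport φ ⊆ Ω

/-- `C_c^∞(Ω)` is dense in `X(Ω)`. -/
def TestDense {n : ℕ} (𝕜 : Type*) [RCLike 𝕜] (N : FunctionNorm n) (Ω : Set (Eucl n)) : Prop :=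
  ∀ h : Eucl n → 𝕜, MemOn N Ω h → ∀ ε : ℝ≥0∞, 0 < ε →
    ∃ φ : Eucl n → 𝕜, IsTest Ω φ ∧ normOn N Ω (fun x => ‖h x - φ x‖ₑ) < ε

/-- `X(Ω)` has an absolutely continuous norm on `Ω`. -/
def HasACNormOn {n : ℕ} (𝕜 : Type*) [RCLike 𝕜] (N : FunctionNorm n) (Ω : Set (Eucl n)) : Prop :=
  ∀ h : Eucl n → 𝕜, MemOn N Ω h → ∀ A : ℕ → Set (Eucl n),
    (∀ j, A j ⊆ Ω) → (∀ j, NullMeasurableSet (A j) volume) →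
    (∀ᵐ x ∂volume.restrict Ω,
      Tendsto (fun j => (A j).indicator (1 : Eucl n → ℝ) x) atTop (𝓝 0)) →
    Tendsto (fun j => normOn N Ω (fun x => ‖(A j).indicator h x‖ₑ)) atTop (𝓝 0)

/-- `X(ℝⁿ)` is locally `β`-doubling. -/
def IsLocallyDoubling {n : ℕ} (N : FunctionNorm n) (β : ℝ) : Prop :=
  ∃ C : ℝ, 0 < C ∧ ∀ r lam : ℝ, 0 < r → 1 ≤ lam →
    N ((Metric.ball 0 (lam * r)).indicator 1) ≤
      ENNReal.ofReal (C * lam ^ β) * N ((Metric.ball 0 r).indicator 1)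

/-- A `ν₀`-radial decreasing approximation of the identity on `ℝⁿ`; `ρ ν` is only used for
`0 < ν < ν₀` and on `(0,∞)`. -/
structure IsRDATI (n : ℕ) (ν₀ : ℝ) (ρ : ℝ → ℝ → ℝ) : Prop where
  nonneg : ∀ ν ∈ Ioo 0 ν₀, ∀ r ∈ Ioi (0 : ℝ), 0 ≤ ρ ν r
  locallyIntegrable : ∀ ν ∈ Ioo 0 ν₀, LocallyIntegrableOn (ρ ν) (Ioi 0) volume
  antitone : ∀ ν ∈ Ioo 0 ν₀, AntitoneOn (ρ ν) (Ioi 0)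
  integral_eq_one : ∀ ν ∈ Ioo 0 ν₀,
    ∫⁻ r in Ioi (0 : ℝ), ENNReal.ofReal (ρ ν r * r ^ ((n : ℝ) - 1)) = 1
  tail : ∀ δ : ℝ, 0 < δ →
    Tendsto (fun ν => ∫⁻ r in Ioi δ, ENNReal.ofReal (ρ ν r * r ^ ((n : ℝ) - 1)))
      (𝓝[>] 0) (𝓝 0)

/-- `x ↦ [∫_Ω |f(x)-f(y)|^p / |x-y|^p ρ(|x-y|) dy]^{1/p}`, with values in `[0,∞]`. -/
def diffQuotient {n : ℕ} {𝕜 : Type*} [RCLike 𝕜] (Ω : Set (Eucl n)) (p : ℝ) (ρ : ℝ → ℝ)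
    (f : Eucl n → 𝕜) (x : Eucl n) : ℝ≥0∞ :=
  (∫⁻ y in Ω, ENNReal.ofReal (‖f x - f y‖ ^ p / ‖x - y‖ ^ p * ρ ‖x - y‖)) ^ (1 / p)

/-- `G` is the weak gradient of `f` on `Ω`. -/
structure IsWeakGradient {n : ℕ} {𝕜 : Type*} [RCLike 𝕜] (Ω : Set (Eucl n)) (f : Eucl n → 𝕜)
    (G : Eucl n → EuclideanSpace 𝕜 (Fin n)) : Prop where
  locallyIntegrable_fun : LocallyIntegrableOn f Ω volume
  locallyIntegrable_grad : LocallyIntegrableOn G Ω volume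
  integral_eq : ∀ (j : Fin n) (φ : Eucl n → 𝕜), IsTest Ω φ →
    ∫ x in Ω, f x * fderiv ℝ φ x (EuclideanSpace.single j 1) = - ∫ x in Ω, G x j * φ x

end BallBanach

end

/-!
The plan is to bound the distributional gradient of `f` as a functional on test functions in the
norm of `X'(Ω)`, to represent it by functions on `Ω`, and to read off the `X(Ω)` norm of these
functions by duality.

*The bound.* Let `φ ∈ C_c^∞(Ω)`, let `δ` be smaller than the distance of its support to the
complement of `Ω`, and let `κ_ν` be the measure with density `ρ_ν(|h|)` on the ball of radius `δ`.
Put `Φ(h) = ∫ f(x) (φ(x + h) - φ(x)) dx`. By Taylor's formula `Φ(h) = ∑ₖ hₖ ∫ f ∂ₖφ + O(|h|²)`,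
and by the symmetry of `κ_ν` the average `∫ hⱼ |h|⁻² Φ(h) dκ_ν` equals
`κ_ν(ℝⁿ)/n ∫ f ∂ⱼφ + O(∫ |h| dκ_ν)`, where `κ_ν(ℝⁿ)` tends to the area of the unit sphere and the
error tends to `0` (`IsTest.enorm_integral_mul_fderiv_le`). On the other hand a translation moves
the difference from `φ` to `f`, so that by Tonelli and Hölder the same average is at most a constant
times `∫ |φ| D_ν` with `D_ν` the difference quotient of exponent `p`
(`IsTest.lintegral_correlation_le`, `lintegral_profile_le_diffQuotient`). The kernel is cut off at
radius `δ` before any norm is taken, hence no tail has to be estimated in `X`. The result is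
`|∫_Ω f ∂ⱼφ| ≤ c ‖φ‖_{X'(Ω)} Λ(f)` (`enorm_integral_mul_fderiv_le_liminf`).

*The representation.* By density the functional extends to `X'(Ω)` (`exists_extension`). Evaluated
at `w 1_E`, for a strictly positive weight `w ∈ X'`, it is a set function, countably additive because
the norm of `X'(Ω)` is absolutely continuous; the Radon–Nikodym theorem gives its density, and
division by `w` gives a weak partial derivative `g` (`exists_representation`).

*The norm.* From `∫ |g| ψ ≤ A ‖ψ‖_{X'}` for all `ψ ≥ 0` it follows that `‖g‖_X ≤ A`. This is the
Lorentz–Luxemburg theorem (`norm_le_of_forall_lintegral_mul_le`); it is obtained by separating a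
truncation of `|g|` from the closed convex set `{v ∈ L² : ‖v‖_X ≤ A}`.
-/

namespace BallBanach

/-! ### The functional of a ball Banach function space and its associate -/

section

variable {n : ℕ} {N : FunctionNorm n}

lemma IsBallBanachNorm.zero (hN : IsBallBanachNorm N) : N 0 = 0 := by
  have h := hN.smul 0 0 aemeasurable_const
  have h0 : (fun x => ((0 : ℝ≥0) : ℝ≥0∞) * (0 : Eucl n → ℝ≥0∞) x) = (0 : Eucl n → ℝ≥0∞) := by
    ext x; simp
  rw [h0] at h
  simpa using h

lemma IsBallBanachNorm.congr (hN : IsBallBanachNorm N) {f g : Eucl n → ℝ≥0∞}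
    (hf : AEMeasurable f volume) (h : f =ᵐ[volume] g) : N f = N g :=
  le_antisymm (hN.mono _ _ (hf.congr h) hf h.le) (hN.mono _ _ hf (hf.congr h) h.symm.le)

lemma IsBallBanachNorm.add_le (hN : IsBallBanachNorm N) {f g : Eucl n → ℝ≥0∞}
    (hf : AEMeasurable f volume) (hg : AEMeasurable g volume) : N (f + g) ≤ N f + N g := by
  by_cases h1 : N f < ∞
  · by_cases h2 : N g < ∞
    · exact hN.add f g hf hg h1 h2
    · simp [not_lt_top_iff.1 h2]
  · simp [not_lt_top_iff.1 h1]

lemma IsBallBanachNorm.sum_le (hN : IsBallBanachNorm N) {ι : Type*} (s : Finset ι)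
    {f : ι → Eucl n → ℝ≥0∞} (hf : ∀ i, AEMeasurable (f i) volume) :
    N (∑ i ∈ s, f i) ≤ ∑ i ∈ s, N (f i) := by
  classical
  induction s using Finset.induction_on with
  | empty => simp [hN.zero]
  | insert i s hi ih =>
    rw [Finset.sum_insert hi, Finset.sum_insert hi]
    exact (hN.add_le (hf i) (Finset.aemeasurable_sum _ fun i _ => hf i)).trans (by gcongr)

/-- Closed balls of a ball Banach function space are closed under almost everywhere limits. -/
lemma IsBallBanachNorm.le_of_ae_tendsto (hN : IsBallBanachNorm N) {f : ℕ → Eucl n → ℝ≥0∞}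
    {g : Eucl n → ℝ≥0∞} (hf : ∀ k, AEMeasurable (f k) volume) {A : ℝ≥0∞}
    (hA : ∀ k, N (f k) ≤ A)
    (hlim : ∀ᵐ x ∂volume, Tendsto (fun k => f k x) atTop (𝓝 (g x))) : N g ≤ A := by
  have hg : AEMeasurable g volume := aemeasurable_of_tendsto_metrizable_ae atTop hf hlim
  have hm : ∀ k, AEMeasurable (fun x => ⨅ j, f (j + k) x) volume :=
    fun k => AEMeasurable.iInf fun j => hf _
  -- apply the Fatou property to the increasing sequence of tail infima
  have key := hN.fatou (fun k x => ⨅ j, f (j + k) x) g hm hg (by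
    filter_upwards [hlim] with x hx
    have hmono : Monotone (fun k => ⨅ j, f (j + k) x) := by
      intro a b hab
      refine le_iInf fun j => (iInf_le _ (j + (b - a))).trans (le_of_eq ?_)
      congr 1; omega
    refine ⟨hmono, ?_⟩
    have h2 := tendsto_atTop_iSup hmono
    have h3 : (⨆ k, ⨅ j, f (j + k) x) = g x := by
      rw [← hx.liminf_eq, liminf_eq_iSup_iInf_of_nat']
    rwa [h3] at h2)
  refine le_of_tendsto' key fun k => (hN.mono _ _ (hf k) (hm k) ?_).trans (hA k)
  exact Eventually.of_forall fun x => (iInf_le _ 0).trans (by simp)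

/-- Hölder's inequality for `X` and `X'`. Finiteness of `N g` cannot be dropped, since the product
`0 * ∞` is `0`. -/
lemma lintegral_mul_le_associate (hN : IsBallBanachNorm N) (f : Eucl n → ℝ≥0∞)
    {g : Eucl n → ℝ≥0∞} (hg : AEMeasurable g volume) (hfin : N g < ∞) :
    ∫⁻ x, f x * g x ≤ associate N f * N g := by
  rcases eq_or_ne (N g) 0 with h0 | h0
  · have hz := hN.ae_zero g hg h0
    rw [h0, mul_zero, nonpos_iff_eq_zero]
    rw [lintegral_congr_ae (g := fun _ => 0), lintegral_zero]
    filter_upwards [hz] with x hx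
    simp [hx]
  · set c : ℝ≥0 := (N g).toNNReal with hc
    have hcN : (c : ℝ≥0∞) = N g := ENNReal.coe_toNNReal hfin.ne
    have hc0 : c ≠ 0 := by
      intro h; rw [h] at hcN; exact h0 (by simpa using hcN.symm)
    have h1 : N (fun x => ((c⁻¹ : ℝ≥0) : ℝ≥0∞) * g x) = 1 := by
      rw [hN.smul _ _ hg, ← hcN, ← ENNReal.coe_mul, inv_mul_cancel₀ hc0, ENNReal.coe_one]
    have h2 : ∫⁻ x, f x * (((c⁻¹ : ℝ≥0) : ℝ≥0∞) * g x) ≤ associate N f :=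
      le_iSup_of_le _ (le_iSup_of_le (hg.const_mul _) (le_iSup_of_le h1 le_rfl))
    calc ∫⁻ x, f x * g x = ∫⁻ x, c * (f x * (((c⁻¹ : ℝ≥0) : ℝ≥0∞) * g x)) := by
          congr 1 with x
          have : (c : ℝ≥0∞) * ((c⁻¹ : ℝ≥0) : ℝ≥0∞) = 1 := by
            rw [← ENNReal.coe_mul, mul_inv_cancel₀ hc0, ENNReal.coe_one]
          calc f x * g x = (c * ((c⁻¹ : ℝ≥0) : ℝ≥0∞)) * (f x * g x) := by rw [this, one_mul]
            _ = _ := by ring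
      _ = c * ∫⁻ x, f x * (((c⁻¹ : ℝ≥0) : ℝ≥0∞) * g x) := lintegral_const_mul' _ _ (by simp)
      _ ≤ c * associate N f := by gcongr
      _ = associate N f * N g := by rw [hcN, mul_comm]

lemma associate_mono_ae {f g : Eucl n → ℝ≥0∞} (h : f ≤ᵐ[volume] g) :
    associate N f ≤ associate N g :=
  iSup_mono fun k => iSup_mono fun _ => iSup_mono fun _ =>
    lintegral_mono_ae (by filter_upwards [h] with x hx using by gcongr)

lemma associate_congr_ae {f g : Eucl n → ℝ≥0∞} (h : f =ᵐ[volume] g) :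
    associate N f = associate N g :=
  le_antisymm (associate_mono_ae h.le) (associate_mono_ae h.symm.le)

lemma associate_zero : associate N 0 = 0 := by
  simp [associate]

lemma associate_const_mul (c : ℝ≥0) (f : Eucl n → ℝ≥0∞) :
    associate N (fun x => c * f x) = c * associate N f := by
  simp only [associate, ENNReal.mul_iSup]
  congr 1 with g
  congr 1 with _
  congr 1 with _
  rw [← lintegral_const_mul' _ _ (by simp)]
  congr 1 with x
  ring

lemma associate_tsum_le {f : ℕ → Eucl n → ℝ≥0∞} (hf : ∀ i, AEMeasurable (f i) volume) :
    associate N (fun x => ∑' i, f i x) ≤ ∑' i, associate N (f i) := by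
  refine iSup_le fun g => iSup_le fun hg => iSup_le fun h1 => ?_
  simp_rw [← ENNReal.tsum_mul_right]
  rw [lintegral_tsum (f := fun i x => f i x * g x) fun i => (hf i).mul hg]
  exact ENNReal.tsum_le_tsum fun i =>
    le_iSup_of_le g (le_iSup_of_le hg (le_iSup_of_le h1 le_rfl))

lemma associate_add_le {f g : Eucl n → ℝ≥0∞} (hf : AEMeasurable f volume) :
    associate N (f + g) ≤ associate N f + associate N g := by
  refine iSup_le fun k => iSup_le fun hk => iSup_le fun h1 => ?_
  simp_rw [Pi.add_apply, add_mul]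
  rw [lintegral_add_left' (f := fun x => f x * k x) (hf.mul hk)]
  exact add_le_add (le_iSup_of_le k (le_iSup_of_le hk (le_iSup_of_le h1 le_rfl)))
    (le_iSup_of_le k (le_iSup_of_le hk (le_iSup_of_le h1 le_rfl)))

lemma associate_indicator_ball_lt_top (hN : IsBallBanachNorm N) (x : Eucl n) {r : ℝ}
    (hr : 0 < r) : associate N ((Metric.ball x r).indicator 1) < ∞ := by
  obtain ⟨C, -, hC⟩ := hN.integral_ball x r hr
  refine lt_of_le_of_lt (b := (C : ℝ≥0∞)) ?_ (by simp)
  refine iSup_le fun k => iSup_le fun hk => iSup_le fun h1 => ?_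
  have := hC k hk (by simp [h1])
  rw [h1, mul_one, ← lintegral_indicator Metric.isOpen_ball.measurableSet] at this
  refine le_trans (le_of_eq ?_) this
  congr 1 with y
  by_cases hy : y ∈ Metric.ball x r <;> simp [hy]

/-- The truncation of a `[0,∞]`-valued function in height and in space. -/
noncomputable def trunc (w : Eucl n → ℝ≥0∞) (k : ℕ) : Eucl n → ℝ≥0∞ :=
  (Metric.ball 0 (k : ℝ)).indicator fun x => min (w x) k

lemma trunc_le (w : Eucl n → ℝ≥0∞) (k : ℕ) (x : Eucl n) : trunc w k x ≤ w x := by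
  unfold trunc
  by_cases h : x ∈ Metric.ball (0 : Eucl n) k <;> simp [h]

lemma trunc_le_natCast (w : Eucl n → ℝ≥0∞) (k : ℕ) (x : Eucl n) : trunc w k x ≤ k := by
  unfold trunc
  by_cases h : x ∈ Metric.ball (0 : Eucl n) k <;> simp [h]

lemma monotone_trunc (w : Eucl n → ℝ≥0∞) (x : Eucl n) : Monotone fun k => trunc w k x := by
  intro a b hab
  have hab' : (a : ℝ) ≤ b := by exact_mod_cast hab
  unfold trunc
  by_cases h : x ∈ Metric.ball (0 : Eucl n) a
  · have h' := Metric.ball_subset_ball hab' h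
    simp only [h, h', indicator_of_mem]
    gcongr
  · simp [h]

lemma tendsto_trunc (w : Eucl n → ℝ≥0∞) (x : Eucl n) :
    Tendsto (fun k => trunc w k x) atTop (𝓝 (w x)) := by
  have h1 : Tendsto (fun k : ℕ => min (w x) k) atTop (𝓝 (min (w x) ∞)) :=
    tendsto_const_nhds.min ENNReal.tendsto_nat_nhds_top
  rw [min_eq_left le_top] at h1
  refine h1.congr' ?_
  obtain ⟨m, hm⟩ := exists_nat_gt ‖x‖
  filter_upwards [eventually_ge_atTop m] with k hk
  have : x ∈ Metric.ball (0 : Eucl n) k := by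
    simpa using hm.trans_le (by exact_mod_cast hk)
  simp [trunc, this]

lemma measurable_trunc {w : Eucl n → ℝ≥0∞} (hw : Measurable w) (k : ℕ) :
    Measurable (trunc w k) :=
  (hw.min measurable_const).indicator Metric.isOpen_ball.measurableSet

lemma memLp_two_of_trunc {w : Eucl n → ℝ≥0∞} (hw : Measurable w) (k : ℕ) {s : Eucl n → ℝ}
    (hs : Measurable s) (C : ℝ) (hsC : ∀ x, |s x| ≤ C) :
    MemLp (fun x => (trunc w k x).toReal * s x) 2 (volume : Measure (Eucl n)) := by
  have hC : 0 ≤ C := (abs_nonneg _).trans (hsC 0)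
  have hm : Measurable (fun x => (trunc w k x).toReal * s x) :=
    (measurable_trunc hw k).ennreal_toReal.mul hs
  have hb : ∀ x, ‖(trunc w k x).toReal * s x‖ ≤
      ‖(Metric.ball (0 : Eucl n) (k : ℝ)).indicator (fun _ => (k : ℝ) * C) x‖ := by
    intro x
    by_cases h : x ∈ Metric.ball (0 : Eucl n) (k : ℝ)
    · have h1 : (trunc w k x).toReal ≤ k := by
        have := ENNReal.toReal_mono (by simp) (trunc_le_natCast w k x)
        simpa using this
      have h2 : |(k : ℝ) * C| = k * C := abs_of_nonneg (by positivity)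
      rw [indicator_of_mem h, norm_mul, Real.norm_eq_abs, Real.norm_eq_abs, Real.norm_eq_abs,
        abs_of_nonneg ENNReal.toReal_nonneg, h2]
      exact mul_le_mul h1 (hsC x) (abs_nonneg _) (by positivity)
    · simp [trunc, h]
  refine MemLp.mono (g := (Metric.ball (0 : Eucl n) (k : ℝ)).indicator fun _ => (k : ℝ) * C)
    ?_ hm.aestronglyMeasurable (Eventually.of_forall hb)
  exact memLp_indicator_const 2 Metric.isOpen_ball.measurableSet _
    (Or.inr measure_ball_lt_top.ne)

end

/-! ### The Lorentz–Luxemburg theorem -/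

section

variable {n : ℕ} {N : FunctionNorm n}

lemma isClosed_lp_norm_le (hN : IsBallBanachNorm N) (A : ℝ≥0∞) :
    IsClosed {v : Lp ℝ 2 (volume : Measure (Eucl n)) | N (fun x => ‖v x‖ₑ) ≤ A} := by
  refine IsSeqClosed.isClosed fun v w hv hvw => ?_
  have h1 := tendstoInMeasure_of_tendsto_Lp hvw
  obtain ⟨ns, -, hns⟩ := h1.exists_seq_tendsto_ae
  refine hN.le_of_ae_tendsto (f := fun k x => ‖v (ns k) x‖ₑ)
    (fun k => (Lp.aestronglyMeasurable _).enorm) (fun k => hv (ns k)) ?_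
  filter_upwards [hns] with x hx using hx.enorm

lemma convex_lp_norm_le (hN : IsBallBanachNorm N) (A : ℝ≥0∞) :
    Convex ℝ {v : Lp ℝ 2 (volume : Measure (Eucl n)) | N (fun x => ‖v x‖ₑ) ≤ A} := by
  intro v hv w hw a b ha hb hab
  have hvm : AEMeasurable (fun x => ‖v x‖ₑ) volume := (Lp.aestronglyMeasurable v).enorm
  have hwm : AEMeasurable (fun x => ‖w x‖ₑ) volume := (Lp.aestronglyMeasurable w).enorm
  lift a to ℝ≥0 using ha
  lift b to ℝ≥0 using hb
  have hab' : (a : ℝ≥0∞) + b = 1 := by exact_mod_cast hab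
  calc N (fun x => ‖((a : ℝ) • v + (b : ℝ) • w : Lp ℝ 2 volume) x‖ₑ)
      ≤ N ((fun x => (a : ℝ≥0∞) * ‖v x‖ₑ) + fun x => (b : ℝ≥0∞) * ‖w x‖ₑ) := by
        refine hN.mono _ _ ((hvm.const_mul _).add (hwm.const_mul _))
          (Lp.aestronglyMeasurable _).enorm ?_
        filter_upwards [Lp.coeFn_add ((a : ℝ) • v) ((b : ℝ) • w), Lp.coeFn_smul (a : ℝ) v,
          Lp.coeFn_smul (b : ℝ) w] with x h1 h2 h3
        rw [h1, Pi.add_apply, Pi.add_apply, h2, h3]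
        refine (enorm_add_le _ _).trans (le_of_eq ?_)
        simp
    _ ≤ a * N (fun x => ‖v x‖ₑ) + b * N (fun x => ‖w x‖ₑ) := by
        refine (hN.add_le (hvm.const_mul _) (hwm.const_mul _)).trans (le_of_eq ?_)
        rw [hN.smul _ _ hvm, hN.smul _ _ hwm]
    _ ≤ a * A + b * A := by gcongr; exacts [hv, hw]
    _ = A := by rw [← add_mul, hab', one_mul]

/-- The Lorentz–Luxemburg theorem for bounded functions with bounded support: such functions lie in
`L²`, where the closed ball `{N ≤ A}` can be separated from a point outside it. -/
lemma norm_trunc_le_of_forall_lintegral_mul_le (hN : IsBallBanachNorm N) {u : Eucl n → ℝ≥0∞}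
    (hu : Measurable u) {A : ℝ≥0}
    (h : ∀ ψ : Eucl n → ℝ≥0∞, AEMeasurable ψ volume → ∫⁻ x, u x * ψ x ≤ A * associate N ψ)
    (k : ℕ) : N (trunc u k) ≤ A := by
  set U := {v : Lp ℝ 2 (volume : Measure (Eucl n)) | N (fun x => ‖v x‖ₑ) ≤ A} with hU
  have hmem := memLp_two_of_trunc hu k (s := fun _ => 1) measurable_const 1 (by simp)
  simp only [mul_one] at hmem
  have htop : ∀ (w : Eucl n → ℝ≥0∞) (k : ℕ) x, trunc w k x ≠ ∞ := fun w k x =>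
    ((trunc_le_natCast w k x).trans_lt (by simp)).ne
  by_contra! hlt
  have hnot : hmem.toLp ∉ U := by
    intro hin
    refine hlt.not_ge (le_trans (le_of_eq ?_) hin)
    refine hN.congr (measurable_trunc hu k).aemeasurable ?_
    filter_upwards [hmem.coeFn_toLp] with x hx
    rw [hx, Real.enorm_of_nonneg ENNReal.toReal_nonneg, ENNReal.ofReal_toReal (htop _ _ _)]
  obtain ⟨F, s, hFs, hsF⟩ := geometric_hahn_banach_closed_point (convex_lp_norm_le hN A)
    (isClosed_lp_norm_le hN A) hnot
  -- the separating functional is the pairing with some `ψ ∈ L²`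
  set ψ : Lp ℝ 2 (volume : Measure (Eucl n)) := (InnerProductSpace.toDual ℝ _).symm F with hψ
  have hF : ∀ v : Lp ℝ 2 (volume : Measure (Eucl n)), F v = ∫ x, ψ x * v x := by
    intro v
    have : F v = inner ℝ ψ v := by
      rw [hψ, InnerProductSpace.toDual_symm_apply]
    rw [this, L2.inner_def]
    congr 1 with x
    simp [mul_comm]
  have hψm : AEMeasurable (fun x => ‖ψ x‖ₑ) volume := (Lp.aestronglyMeasurable ψ).enorm
  have hψsm : Measurable ψ := (Lp.stronglyMeasurable ψ).measurable
  have hsgn : Measurable fun x => (SignType.sign (ψ x) : ℝ) := by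
    have : (fun x => (SignType.sign (ψ x) : ℝ)) =
        fun x => if 0 < ψ x then (1 : ℝ) else if ψ x < 0 then -1 else 0 := by
      ext x
      rcases lt_trichotomy (ψ x) 0 with h | h | h
      · simp [h, h.not_gt]
      · simp [h]
      · simp [h]
    rw [this]
    exact Measurable.ite (hψsm measurableSet_Ioi) measurable_const
      (Measurable.ite (hψsm measurableSet_Iio) measurable_const measurable_const)
  -- testing against truncations of unit vectors bounds the associate norm of `ψ`
  have hassoc : A * associate N (fun x => ‖ψ x‖ₑ) ≤ ENNReal.ofReal s := by
    simp only [associate, ENNReal.mul_iSup]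
    refine iSup_le fun w => iSup_le fun hw => iSup_le fun hw1 => ?_
    set w' := hw.mk w
    have hw'1 : N w' = 1 := by rw [← hw1]; exact (hN.congr hw hw.ae_eq_mk).symm
    have hw'm : Measurable w' := hw.measurable_mk
    have hint : ∀ k : ℕ, A * ∫⁻ x, ‖ψ x‖ₑ * trunc w' k x ≤ ENNReal.ofReal s := by
      intro k
      have hm2 := memLp_two_of_trunc hw'm k (s := fun x => A * (SignType.sign (ψ x) : ℝ))
        (hsgn.const_mul _) A (by
          intro x
          rw [abs_mul, NNReal.abs_eq]
          refine mul_le_of_le_one_right A.2 ?_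
          cases SignType.sign (ψ x) <;> simp)
      have hvU : hm2.toLp ∈ U := by
        show N _ ≤ A
        calc N (fun x => ‖hm2.toLp _ x‖ₑ) ≤ N (fun x => A * w' x) := by
              refine hN.mono _ _ (hw'm.const_mul _).aemeasurable
                (Lp.aestronglyMeasurable _).enorm ?_
              filter_upwards [hm2.coeFn_toLp] with x hx
              rw [hx, enorm_mul, enorm_mul, Real.enorm_of_nonneg ENNReal.toReal_nonneg,
                ENNReal.ofReal_toReal (htop _ _ _)]
              have h1 : ‖(SignType.sign (ψ x) : ℝ)‖ₑ ≤ 1 := by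
                cases SignType.sign (ψ x) <;> simp
              have h2 : ‖(A : ℝ)‖ₑ = A := by simp
              rw [h2]
              calc trunc w' k x * (A * ‖(SignType.sign (ψ x) : ℝ)‖ₑ)
                  ≤ w' x * (A * 1) := by gcongr; exact trunc_le _ _ _
                _ = A * w' x := by ring
          _ = A := by rw [hN.smul _ _ hw'm.aemeasurable, hw'1, mul_one]
      have hlt := hFs _ hvU
      rw [hF] at hlt
      have heq : ∫ x, ψ x * hm2.toLp _ x = ∫ x, ‖ψ x‖ * ((trunc w' k x).toReal * A) := by
        refine integral_congr_ae ?_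
        filter_upwards [hm2.coeFn_toLp] with x hx
        rw [hx]
        have := self_mul_sign (ψ x)
        rw [Real.norm_eq_abs, ← this]
        ring
      have hi : Integrable (fun x => ‖ψ x‖ * ((trunc w' k x).toReal * A)) volume := by
        have h3 := memLp_two_of_trunc hw'm k (s := fun x => (A : ℝ)) measurable_const A (by simp)
        exact (Lp.memLp ψ).norm.integrable_mul h3
      rw [heq] at hlt
      have := ofReal_integral_eq_lintegral_ofReal hi (Eventually.of_forall fun x => by positivity)
      rw [← lintegral_const_mul' _ _ (by simp)]
      refine le_trans (le_of_eq ?_) (this.symm.trans_le (ENNReal.ofReal_le_ofReal hlt.le))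
      congr 1 with x
      rw [ENNReal.ofReal_mul (norm_nonneg _), ENNReal.ofReal_mul ENNReal.toReal_nonneg,
        ENNReal.ofReal_toReal (htop _ _ _), ofReal_norm, ENNReal.ofReal_coe_nnreal]
      ring
    have hlim : Tendsto (fun k => A * ∫⁻ x, ‖ψ x‖ₑ * trunc w' k x) atTop
        (𝓝 (A * ∫⁻ x, ‖ψ x‖ₑ * w' x)) := by
      refine ENNReal.Tendsto.const_mul ?_ (Or.inr (by simp))
      refine lintegral_tendsto_of_tendsto_of_monotone
        (fun k => hψm.mul (measurable_trunc hw'm k).aemeasurable)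
        (Eventually.of_forall fun x a b hab => ?_) (Eventually.of_forall fun x => ?_)
      · have := monotone_trunc w' x hab
        simp only at this ⊢
        gcongr
      · exact ENNReal.Tendsto.const_mul (tendsto_trunc w' x) (Or.inr (by simp))
    have := le_of_tendsto' hlim hint
    refine le_trans (le_of_eq ?_) this
    congr 1
    refine lintegral_congr_ae ?_
    filter_upwards [hw.ae_eq_mk] with x hx
    rw [hx]
  have h1 : ENNReal.ofReal (F hmem.toLp) ≤ ENNReal.ofReal s := by
    refine le_trans ?_ ((h _ hψm).trans hassoc)
    rw [hF]
    calc ENNReal.ofReal (∫ x, ψ x * hmem.toLp _ x) ≤ ‖∫ x, ψ x * hmem.toLp _ x‖ₑ :=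
          Real.ofReal_le_enorm _
      _ ≤ ∫⁻ x, ‖ψ x * hmem.toLp _ x‖ₑ := enorm_integral_le_lintegral_enorm _
      _ ≤ ∫⁻ x, u x * ‖ψ x‖ₑ := by
        refine lintegral_mono_ae ?_
        filter_upwards [hmem.coeFn_toLp] with x hx
        rw [hx, enorm_mul, Real.enorm_of_nonneg ENNReal.toReal_nonneg,
          ENNReal.ofReal_toReal (htop _ _ _), mul_comm]
        gcongr
        exact trunc_le _ _ _
  have h0 : 0 < s := by
    have := hFs 0 (by
      show N _ ≤ A
      have : N (fun x => ‖(0 : Lp ℝ 2 (volume : Measure (Eucl n))) x‖ₑ) = 0 := by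
        rw [← hN.zero]
        exact hN.congr (Lp.aestronglyMeasurable _).enorm (Eventually.of_forall fun x => by simp)
      exact this.trans_le (by simp))
    simpa using this
  exact hsF.not_ge ((ENNReal.ofReal_le_ofReal_iff h0.le).1 h1)

/-- The Lorentz–Luxemburg theorem: a function which acts on the associate space with norm at most
`A` has norm at most `A`. -/
theorem norm_le_of_forall_lintegral_mul_le (hN : IsBallBanachNorm N) {u : Eucl n → ℝ≥0∞}
    (hu : AEMeasurable u volume) {A : ℝ≥0}
    (h : ∀ ψ : Eucl n → ℝ≥0∞, AEMeasurable ψ volume → ∫⁻ x, u x * ψ x ≤ A * associate N ψ) :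
    N u ≤ A := by
  have hk := norm_trunc_le_of_forall_lintegral_mul_le hN (u := hu.mk u) hu.measurable_mk (A := A)
    (fun ψ hψ => by
      refine le_trans (le_of_eq (lintegral_congr_ae ?_)) (h ψ hψ)
      filter_upwards [hu.ae_eq_mk] with x hx
      rw [hx])
  rw [hN.congr hu hu.ae_eq_mk]
  exact hN.le_of_ae_tendsto (fun k => (measurable_trunc hu.measurable_mk k).aemeasurable) hk
    (Eventually.of_forall fun x => tendsto_trunc _ x)

end

/-! ### A Radon–Nikodym theorem for scalar set functions -/

/-- A Radon–Nikodym theorem for scalar set functions: finite additivity and domination by a monotone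
set function `τ` that is continuous at `∅` give countable additivity. -/
theorem exists_integrable_forall_eq_setIntegral {α : Type*} [MeasurableSpace α] (μ : Measure α)
    [SigmaFinite μ] {𝕜 : Type*} [RCLike 𝕜] (m : Set α → 𝕜) (τ : Set α → ℝ≥0∞)
    (hadd : ∀ E F, MeasurableSet E → MeasurableSet F → Disjoint E F → m (E ∪ F) = m E + m F)
    (hmτ : ∀ E, MeasurableSet E → ‖m E‖ₑ ≤ τ E) (hτ : Monotone τ)
    (hcont : ∀ E : ℕ → Set α, (∀ k, MeasurableSet (E k)) → Antitone E → ⋂ k, E k = ∅ →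
      Tendsto (fun k => τ (E k)) atTop (𝓝 0))
    (hac : ∀ E, MeasurableSet E → μ E = 0 → m E = 0) :
    ∃ g : α → 𝕜, Integrable g μ ∧ ∀ E, MeasurableSet E → m E = ∫ x in E, g x ∂μ := by
  classical
  have hempty : m ∅ = 0 := by
    have := hadd ∅ ∅ .empty .empty (by simp)
    simpa using this
  have hfin : ∀ (f : ℕ → Set α), (∀ i, MeasurableSet (f i)) → Pairwise (Function.onFun Disjoint f) →
      ∀ s : Finset ℕ, m (⋃ i ∈ s, f i) = ∑ i ∈ s, m (f i) := by
    intro f hf hd s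
    induction s using Finset.induction_on with
    | empty => simp [hempty]
    | insert i s hi ih =>
      rw [Finset.set_biUnion_insert, Finset.sum_insert hi, hadd _ _ (hf i)
        (s.measurableSet_biUnion fun j _ => hf j), ih]
      rw [disjoint_iUnion₂_right]
      exact fun j hj => hd (fun h => hi (h ▸ hj))
  -- the error of a partial sum over `s ⊇ {0, …, k - 1}` is the value at a subset of the `k`-th tail
  let v : VectorMeasure α 𝕜 :=
    { measureOf' := fun E => if MeasurableSet E then m E else 0
      empty' := by simp [hempty]
      not_measurable' := fun E hE => by simp [hE]
      m_iUnion' := by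
        intro f hf hd
        simp only [hf, MeasurableSet.iUnion hf, if_true]
        have htail := hcont (fun k => ⋃ i ∈ Ici k, f i)
          (fun k => MeasurableSet.biUnion (to_countable _) fun i _ => hf i)
          (fun a b hab => biUnion_subset_biUnion_left (Ici_subset_Ici.2 hab)) (by
            ext x
            simp only [mem_iInter, mem_iUnion, mem_Ici, exists_prop, mem_empty_iff_false,
              iff_false, not_forall]
            by_cases hx : ∃ i, x ∈ f i
            · obtain ⟨i, hi⟩ := hx
              refine ⟨i + 1, ?_⟩
              rintro ⟨j, hj, hxj⟩
              exact (hd (show i ≠ j by omega)).le_bot ⟨hi, hxj⟩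
            · exact ⟨0, fun ⟨j, _, hxj⟩ => hx ⟨j, hxj⟩⟩)
        rw [HasSum, tendsto_iff_edist_tendsto_0, ENNReal.tendsto_nhds_zero]
        intro ε hε
        obtain ⟨k, hk⟩ := (ENNReal.tendsto_nhds_zero.1 htail ε hε).exists
        filter_upwards [eventually_ge_atTop (Finset.range k)] with s hs
        have hsplit : ⋃ i, f i = (⋃ i ∈ s, f i) ∪ ⋃ i ∈ {i | i ∉ s}, f i := by
          ext x
          simp only [mem_iUnion, mem_union, mem_ofPred_eq, exists_prop]
          constructor
          · rintro ⟨i, hi⟩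
            by_cases his : i ∈ s
            · exact Or.inl ⟨i, his, hi⟩
            · exact Or.inr ⟨i, his, hi⟩
          · rintro (⟨i, -, hi⟩ | ⟨i, -, hi⟩) <;> exact ⟨i, hi⟩
        have hmr : MeasurableSet (⋃ i ∈ {i | i ∉ s}, f i) :=
          MeasurableSet.biUnion (to_countable _) fun i _ => hf i
        rw [hsplit, hadd _ _ (s.measurableSet_biUnion fun j _ => hf j) hmr, hfin f hf hd s,
          edist_comm, edist_eq_enorm_sub, add_sub_cancel_left]
        · refine (hmτ _ hmr).trans ((hτ ?_).trans hk)
          refine biUnion_subset_biUnion_left fun i hi => ?_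
          by_contra hik
          exact hi (hs (Finset.mem_range.2 (not_le.1 hik)))
        · rw [disjoint_iUnion₂_left]
          intro i hi
          rw [disjoint_iUnion₂_right]
          exact fun j hj => hd (fun h => hj (h ▸ hi)) }
  have hv : ∀ E, MeasurableSet E → v E = m E := fun E hE => if_pos hE
  -- the real and the imaginary part are signed measures
  have hreal : ∀ F : 𝕜 →L[ℝ] ℝ, ∃ g : α → ℝ, Integrable g μ ∧
      ∀ E, MeasurableSet E → F (m E) = ∫ x in E, g x ∂μ := by
    intro F
    let s : SignedMeasure α := v.mapRange F.toLinearMap.toAddMonoidHom F.continuous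
    have hs : ∀ E, MeasurableSet E → s E = F (m E) := fun E hE => by
      change F (v E) = _
      rw [hv E hE]
    have hsac : s ≪ᵥ μ.toENNRealVectorMeasure := by
      refine VectorMeasure.AbsolutelyContinuous.mk fun E hE h0 => ?_
      rw [Measure.toENNRealVectorMeasure_apply_measurable hE] at h0
      rw [hs E hE, hac E hE h0, map_zero]
    refine ⟨s.rnDeriv μ, SignedMeasure.integrable_rnDeriv _ _, fun E hE => ?_⟩
    rw [← hs E hE, ← withDensityᵥ_apply (SignedMeasure.integrable_rnDeriv _ _) hE,
      SignedMeasure.withDensityᵥ_rnDeriv_eq s μ hsac]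
  obtain ⟨g1, hg1, h1⟩ := hreal RCLike.reCLM
  obtain ⟨g2, hg2, h2⟩ := hreal RCLike.imCLM
  refine ⟨fun x => (g1 x : 𝕜) + (g2 x : 𝕜) * RCLike.I, hg1.ofReal.add (hg2.ofReal.mul_const _),
    fun E hE => ?_⟩
  have i1 : Integrable (fun x => (g1 x : 𝕜)) (μ.restrict E) := hg1.integrableOn.ofReal
  have i2 : Integrable (fun x => (g2 x : 𝕜)) (μ.restrict E) := hg2.integrableOn.ofReal
  rw [integral_add i1 (i2.mul_const _), integral_mul_const, integral_ofReal, integral_ofReal,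
    ← h1 E hE, ← h2 E hE]
  exact (RCLike.re_add_im _).symm

/-! ### Restrictive spaces and extension of functionals by density -/

section

variable {n : ℕ} {N : FunctionNorm n} {Ω : Set (Eucl n)} {𝕜 : Type*} [RCLike 𝕜]

/-- The norm of a restrictive space is attained at the extension by zero, for a functional that is
monotone on measurable functions. -/
lemma normOn_eq_indicator (hΩ : MeasurableSet Ω)
    (hmono : ∀ f g : Eucl n → ℝ≥0∞, AEMeasurable f volume → AEMeasurable g volume →
      g ≤ᵐ[volume] f → N g ≤ N f) {h : Eucl n → ℝ≥0∞} (hh : AEMeasurable h (volume.restrict Ω)) :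
    normOn N Ω h = N (Ω.indicator h) := by
  have hm : AEMeasurable (Ω.indicator h) volume := (aemeasurable_indicator_iff hΩ).2 hh
  refine le_antisymm (iInf_le_of_le _ (iInf_le_of_le hm (iInf_le_of_le ?_ le_rfl))) ?_
  · exact indicator_ae_eq_restrict hΩ
  · refine le_iInf fun g => le_iInf fun hg => le_iInf fun hgh => hmono _ _ hg hm ?_
    rw [Filter.EventuallyEq, ae_restrict_iff' hΩ] at hgh
    filter_upwards [hgh] with x hx
    by_cases hxΩ : x ∈ Ω
    · rw [indicator_of_mem hxΩ, hx hxΩ]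
    · simp [hxΩ]

lemma IsBallBanachNorm.normOn_eq (hN : IsBallBanachNorm N) (hΩ : MeasurableSet Ω)
    {h : Eucl n → ℝ≥0∞} (hh : AEMeasurable h (volume.restrict Ω)) :
    normOn N Ω h = N (Ω.indicator h) := normOn_eq_indicator hΩ hN.mono hh

lemma normOn_associate_eq (hΩ : MeasurableSet Ω)
    {h : Eucl n → ℝ≥0∞} (hh : AEMeasurable h (volume.restrict Ω)) :
    normOn (associate N) Ω h = associate N (Ω.indicator h) :=
  normOn_eq_indicator hΩ (fun _ _ _ _ h => associate_mono_ae h) hh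

/-- The norm of `𝕜`-valued functions in `X'(Ω)`. -/
noncomputable def assocNorm (N : FunctionNorm n) (Ω : Set (Eucl n)) (h : Eucl n → 𝕜) : ℝ≥0∞ :=
  associate N (Ω.indicator fun x => ‖h x‖ₑ)

lemma normOn_associate_enorm (hΩ : MeasurableSet Ω) {h : Eucl n → 𝕜}
    (hh : AEStronglyMeasurable h (volume.restrict Ω)) :
    normOn (associate N) Ω (fun x => ‖h x‖ₑ) = assocNorm N Ω h :=
  normOn_associate_eq hΩ hh.enorm

lemma memOn_associate_iff (hΩ : MeasurableSet Ω) {h : Eucl n → 𝕜} :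
    MemOn (associate N) Ω h ↔
      AEStronglyMeasurable h (volume.restrict Ω) ∧ assocNorm N Ω h < ∞ := by
  constructor
  · exact fun H => ⟨H.1, (normOn_associate_enorm hΩ H.1).symm.trans_lt H.2⟩
  · exact fun H => ⟨H.1, (normOn_associate_enorm hΩ H.1).trans_lt H.2⟩

lemma assocNorm_mono_ae {h k : Eucl n → 𝕜} (hΩ : MeasurableSet Ω)
    (H : ∀ᵐ x ∂(volume.restrict Ω), ‖h x‖ ≤ ‖k x‖) : assocNorm N Ω h ≤ assocNorm N Ω k := by
  refine associate_mono_ae ?_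
  rw [ae_restrict_iff' hΩ] at H
  filter_upwards [H] with x hx
  by_cases hxΩ : x ∈ Ω
  · simpa [hxΩ, enorm_le_iff_norm_le] using hx hxΩ
  · simp [hxΩ]

lemma assocNorm_add_le (hΩ : MeasurableSet Ω) {h k : Eucl n → 𝕜}
    (hh : AEStronglyMeasurable h (volume.restrict Ω)) :
    assocNorm N Ω (fun x => h x + k x) ≤ assocNorm N Ω h + assocNorm N Ω k := by
  refine le_trans (associate_mono_ae (Eventually.of_forall fun x => ?_))
    (associate_add_le ((aemeasurable_indicator_iff hΩ).2 hh.enorm))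
  by_cases hxΩ : x ∈ Ω
  · simpa [hxΩ] using enorm_add_le (h x) (k x)
  · simp [hxΩ]

lemma assocNorm_sub_comm (h k : Eucl n → 𝕜) :
    assocNorm N Ω (fun x => h x - k x) = assocNorm N Ω (fun x => k x - h x) := by
  unfold assocNorm
  congr 2 with x
  rw [← enorm_neg, neg_sub]

lemma assocNorm_sub_le (hΩ : MeasurableSet Ω) {h k l : Eucl n → 𝕜}
    (hh : AEStronglyMeasurable h (volume.restrict Ω))
    (hk : AEStronglyMeasurable k (volume.restrict Ω)) :
    assocNorm N Ω (fun x => h x - l x) ≤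
      assocNorm N Ω (fun x => h x - k x) + assocNorm N Ω (fun x => k x - l x) := by
  refine le_trans (le_of_eq ?_) (assocNorm_add_le hΩ (hh.sub hk))
  congr 1 with x
  simp

lemma assocNorm_const_mul (c : 𝕜) (h : Eucl n → 𝕜) :
    assocNorm N Ω (fun x => c * h x) = ‖c‖ₑ * assocNorm N Ω h := by
  unfold assocNorm
  rw [← enorm_norm c, enorm_norm c, enorm_eq_nnnorm, ← associate_const_mul]
  congr 1 with x
  by_cases hxΩ : x ∈ Ω <;> simp [hxΩ, enorm_eq_nnnorm]

lemma IsTest.continuous {φ : Eucl n → 𝕜} (hφ : IsTest Ω φ) : Continuous φ := hφ.smooth.continuous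

lemma isTest_zero : IsTest Ω (fun _ => (0 : 𝕜)) :=
  ⟨contDiff_const, HasCompactSupport.zero, by simp [tsupport, Function.support]⟩

lemma IsTest.add {φ ψ : Eucl n → 𝕜} (hφ : IsTest Ω φ) (hψ : IsTest Ω ψ) :
    IsTest Ω (fun x => φ x + ψ x) :=
  ⟨hφ.smooth.add hψ.smooth, hφ.compact.add hψ.compact,
    (tsupport_add φ ψ).trans (union_subset hφ.subset hψ.subset)⟩

lemma IsTest.const_mul {φ : Eucl n → 𝕜} (hφ : IsTest Ω φ) (c : 𝕜) :
    IsTest Ω (fun x => c * φ x) :=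
  ⟨contDiff_const.mul hφ.smooth, hφ.compact.mul_left,
    (closure_mono (Function.support_mul_subset_right (fun _ => c) φ)).trans hφ.subset⟩

/-- A linear functional on test functions that is bounded in the norm of `X'(Ω)` extends to
`X'(Ω)` when test functions are dense. -/
theorem exists_extension (hΩ : MeasurableSet Ω) (hdense : TestDense 𝕜 (associate N) Ω)
    (L : (Eucl n → 𝕜) → 𝕜) (A : ℝ≥0)
    (hadd : ∀ φ ψ, IsTest Ω φ → IsTest Ω ψ → L (fun x => φ x + ψ x) = L φ + L ψ)
    (hmul : ∀ (c : 𝕜) φ, IsTest Ω φ → L (fun x => c * φ x) = c * L φ)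
    (hbound : ∀ φ, IsTest Ω φ → ‖L φ‖ₑ ≤ A * assocNorm N Ω φ) :
    ∃ T : (Eucl n → 𝕜) → 𝕜,
      (∀ h k, MemOn (associate N) Ω h → MemOn (associate N) Ω k →
        T (fun x => h x + k x) = T h + T k) ∧
      (∀ (c : 𝕜) h, MemOn (associate N) Ω h → T (fun x => c * h x) = c * T h) ∧
      (∀ h, MemOn (associate N) Ω h → ‖T h‖ₑ ≤ A * assocNorm N Ω h) ∧
      (∀ φ, IsTest Ω φ → MemOn (associate N) Ω φ → T φ = L φ) := by
  have hcm : ∀ {φ : Eucl n → 𝕜}, IsTest Ω φ → AEStronglyMeasurable φ (volume.restrict Ω) :=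
    fun hφ => hφ.continuous.aestronglyMeasurable
  have hsub : ∀ φ ψ, IsTest Ω φ → IsTest Ω ψ →
      ‖L φ - L ψ‖ₑ ≤ A * assocNorm N Ω (fun x => φ x - ψ x) := by
    intro φ ψ hφ hψ
    have h1 := hbound _ (hφ.add (hψ.const_mul (-1)))
    rw [hadd _ _ hφ (hψ.const_mul _), hmul _ _ hψ] at h1
    simpa [sub_eq_add_neg] using h1
  have hd : ∀ h, MemOn (associate N) Ω h → ∀ ε : ℝ≥0∞, 0 < ε →
      ∃ φ : Eucl n → 𝕜, IsTest Ω φ ∧ assocNorm N Ω (fun x => h x - φ x) < ε := by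
    intro h hh ε hε
    obtain ⟨φ, hφ, hlt⟩ := hdense h hh ε hε
    refine ⟨φ, hφ, ?_⟩
    rwa [normOn_associate_enorm hΩ (h := fun x => h x - φ x) (hh.1.sub (hcm hφ))] at hlt
  -- an identity between values of the extension only has to be shown up to `B * ε`
  have hsmall : ∀ (z : 𝕜) (B : ℝ≥0), (∀ ε : ℝ≥0∞, 0 < ε → ‖z‖ₑ ≤ B * ε) → z = 0 := by
    intro z B hz
    rw [← enorm_eq_zero, ← nonpos_iff_eq_zero]
    refine ENNReal.le_of_forall_pos_le_add fun ε hε _ => ?_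
    refine (hz (ε / (B + 1)) (ENNReal.div_pos (by simpa using hε.ne') (by simp))).trans ?_
    rw [zero_add]
    calc (B : ℝ≥0∞) * _ ≤ (B + 1) * (ε / (B + 1)) := by gcongr; exact le_self_add
      _ = ε := by
        rw [ENNReal.mul_div_cancel (by simp) (by simp)]
  have hex : ∀ h, MemOn (associate N) Ω h → ∃ t : 𝕜, ∀ φ, IsTest Ω φ →
      ‖L φ - t‖ₑ ≤ A * assocNorm N Ω (fun x => h x - φ x) := by
    intro h hh
    have hpos : ∀ k : ℕ, (0 : ℝ≥0∞) < ((k : ℝ≥0∞) + 1)⁻¹ := fun k => by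
      simp
    choose φ hφ hlt using fun k : ℕ => hd h hh _ (hpos k)
    have h0 : Tendsto (fun k : ℕ => ((k : ℝ≥0∞) + 1)⁻¹) atTop (𝓝 0) := by
      have := (tendsto_add_atTop_iff_nat 1).2 ENNReal.tendsto_inv_nat_nhds_zero
      simpa using this
    have hA0 : Tendsto (fun k : ℕ => (A : ℝ≥0∞) * (((k : ℝ≥0∞) + 1)⁻¹ + ((k : ℝ≥0∞) + 1)⁻¹))
        atTop (𝓝 0) := by
      have := ENNReal.Tendsto.const_mul (a := (A : ℝ≥0∞)) (h0.add h0) (Or.inr (by simp))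
      simpa using this
    have hdiff : ∀ ψ, IsTest Ω ψ → ∀ k, ‖L ψ - L (φ k)‖ₑ ≤
        A * (assocNorm N Ω (fun x => h x - ψ x) + ((k : ℝ≥0∞) + 1)⁻¹) := by
      intro ψ hψ k
      refine (hsub _ _ hψ (hφ k)).trans ?_
      gcongr
      refine (assocNorm_sub_le hΩ (hcm hψ) hh.1).trans ?_
      rw [assocNorm_sub_comm]
      gcongr
      exact (hlt k).le
    have hcauchy : CauchySeq fun k => L (φ k) := by
      rw [EMetric.cauchySeq_iff_le_tendsto_0]
      refine ⟨_, fun a b k ha hb => ?_, hA0⟩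
      have hanti : ∀ {a : ℕ}, k ≤ a → ((a : ℝ≥0∞) + 1)⁻¹ ≤ ((k : ℝ≥0∞) + 1)⁻¹ := fun h => by
        gcongr
      rw [edist_eq_enorm_sub]
      refine (hdiff _ (hφ a) b).trans ?_
      gcongr
      · exact (hlt a).le.trans (hanti ha)
    obtain ⟨t, ht⟩ := cauchySeq_tendsto_of_complete hcauchy
    refine ⟨t, fun ψ hψ => ?_⟩
    have h1 : Tendsto (fun k => ‖L ψ - L (φ k)‖ₑ) atTop (𝓝 ‖L ψ - t‖ₑ) :=
      (tendsto_const_nhds.sub ht).enorm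
    have h2 : Tendsto (fun k : ℕ => (A : ℝ≥0∞) *
        (assocNorm N Ω (fun x => h x - ψ x) + ((k : ℝ≥0∞) + 1)⁻¹)) atTop
        (𝓝 (A * (assocNorm N Ω (fun x => h x - ψ x) + 0))) :=
      ENNReal.Tendsto.const_mul (tendsto_const_nhds.add h0) (Or.inr (by simp))
    rw [add_zero] at h2
    exact le_of_tendsto_of_tendsto' h1 h2 (hdiff ψ hψ)
  classical
  -- the bound against every test function determines the value, so any choice is linear
  choose! T hT using hex
  have hmem_add : ∀ {h k : Eucl n → 𝕜}, MemOn (associate N) Ω h → MemOn (associate N) Ω k →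
      MemOn (associate N) Ω (fun x => h x + k x) := by
    intro h k hh hk
    rw [memOn_associate_iff hΩ] at hh hk ⊢
    exact ⟨hh.1.add hk.1, (assocNorm_add_le hΩ hh.1).trans_lt (ENNReal.add_lt_top.2 ⟨hh.2, hk.2⟩)⟩
  have hmem_mul : ∀ (c : 𝕜) {h : Eucl n → 𝕜}, MemOn (associate N) Ω h →
      MemOn (associate N) Ω (fun x => c * h x) := by
    intro c h hh
    rw [memOn_associate_iff hΩ] at hh ⊢
    refine ⟨hh.1.const_mul c, ?_⟩
    rw [assocNorm_const_mul]
    exact ENNReal.mul_lt_top (by simp) hh.2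
  have hL0 : L (fun _ => 0) = 0 := by
    have := hmul 0 _ (isTest_zero (Ω := Ω) (𝕜 := 𝕜))
    simpa using this
  refine ⟨T, ?_, ?_, ?_, ?_⟩
  · intro h k hh hk
    rw [← sub_eq_zero]
    refine hsmall _ (4 * A) fun ε hε => ?_
    obtain ⟨φ, hφ, hφlt⟩ := hd h hh ε hε
    obtain ⟨ψ, hψ, hψlt⟩ := hd k hk ε hε
    have e1 := hT _ (hmem_add hh hk) _ (hφ.add hψ)
    rw [hadd _ _ hφ hψ] at e1
    have e2 : assocNorm N Ω (fun x => h x + k x - (φ x + ψ x)) ≤ ε + ε := by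
      have := assocNorm_add_le (N := N) (h := fun x => h x - φ x) (k := fun x => k x - ψ x) hΩ
        (hh.1.sub (hcm hφ))
      refine le_trans (le_of_eq ?_) (this.trans (add_le_add hφlt.le hψlt.le))
      congr 1 with x
      ring
    have e3 := hT h hh φ hφ
    have e4 := hT k hk ψ hψ
    calc ‖T (fun x => h x + k x) - (T h + T k)‖ₑ
        = ‖(L φ - T h) + (L ψ - T k) - (L φ + L ψ - T fun x => h x + k x)‖ₑ := by
          congr 1; ring
      _ ≤ ‖L φ - T h‖ₑ + ‖L ψ - T k‖ₑ + ‖L φ + L ψ - T fun x => h x + k x‖ₑ :=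
          enorm_sub_le.trans (add_le_add (enorm_add_le _ _) le_rfl)
      _ ≤ A * ε + A * ε + A * (ε + ε) := by
          gcongr
          · exact e3.trans (by gcongr)
          · exact e4.trans (by gcongr)
          · exact e1.trans (by gcongr)
      _ = (4 * A : ℝ≥0) * ε := by push_cast; ring
  · intro c h hh
    rw [← sub_eq_zero]
    refine hsmall _ (2 * A * ‖c‖₊) fun ε hε => ?_
    obtain ⟨φ, hφ, hφlt⟩ := hd h hh ε hε
    have e1 := hT _ (hmem_mul c hh) _ (hφ.const_mul c)
    rw [hmul _ _ hφ] at e1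
    have e2 : assocNorm N Ω (fun x => c * h x - c * φ x) ≤ ‖c‖ₑ * ε := by
      simp_rw [← mul_sub]
      rw [assocNorm_const_mul]
      gcongr
    have e3 := hT h hh φ hφ
    calc ‖T (fun x => c * h x) - c * T h‖ₑ
        = ‖c * (L φ - T h) - (c * L φ - T fun x => c * h x)‖ₑ := by
          congr 1; ring
      _ ≤ ‖c‖ₑ * ‖L φ - T h‖ₑ + ‖c * L φ - T fun x => c * h x‖ₑ := by
          rw [← enorm_mul]
          exact enorm_sub_le
      _ ≤ ‖c‖ₑ * (A * ε) + A * (‖c‖ₑ * ε) := by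
          gcongr
          · exact e3.trans (by gcongr)
          · exact e1.trans (by gcongr)
      _ = (2 * A * ‖c‖₊ : ℝ≥0) * ε := by push_cast; rw [enorm_eq_nnnorm]; ring
  · intro h hh
    have := hT h hh _ isTest_zero
    simpa [hL0] using this
  · intro φ hφ hm
    have := hT φ hm φ hφ
    have h0 : assocNorm N Ω (fun x => φ x - φ x) = 0 := by
      simp [assocNorm, associate]
    rw [h0, mul_zero, nonpos_iff_eq_zero, enorm_eq_zero, sub_eq_zero] at this
    exact this.symm

end

/-! ### Representation of functionals on `X'(Ω)` -/

section

variable {n : ℕ} {N : FunctionNorm n} {Ω : Set (Eucl n)} {𝕜 : Type*} [RCLike 𝕜]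

/-- The associate space contains a function that is bounded below by a positive constant on every
ball. -/
lemma exists_weight (hN : IsBallBanachNorm N) :
    ∃ w : Eucl n → ℝ, Measurable w ∧ (∀ x, 0 < w x) ∧
      (∀ R : ℝ, ∃ c : ℝ, 0 < c ∧ ∀ x ∈ Metric.ball 0 R, c ≤ w x) ∧
      associate N (fun x => ‖w x‖ₑ) < ∞ := by
  -- constants on the shells `k ≤ |x| < k + 1`, small enough for the norms to be summable
  obtain ⟨δ, hδ, hsum⟩ := ENNReal.exists_pos_tsum_mul_lt_of_countable (ε := 1) (by simp)
    (fun k : ℕ => associate N ((Metric.ball (0 : Eucl n) ((k : ℝ) + 1)).indicator 1))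
    (fun k => (associate_indicator_ball_lt_top hN 0 (by positivity)).ne)
  refine ⟨fun x => δ ⌊‖x‖⌋₊, ?_, fun x => by exact_mod_cast hδ _, ?_, ?_⟩
  · exact (measurable_from_nat (f := fun k => (δ k : ℝ))).comp
      (Nat.measurable_floor.comp measurable_norm)
  · intro R
    obtain ⟨m, hm, hmin⟩ := Finset.exists_min_image (Finset.range (⌊R⌋₊ + 1)) δ ⟨0, by simp⟩
    refine ⟨δ m, by exact_mod_cast hδ m, fun x hx => ?_⟩
    have hx' : ‖x‖ < R := by simpa using hx
    exact_mod_cast hmin _ (Finset.mem_range.2 (Nat.lt_succ_of_le (Nat.floor_mono hx'.le)))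
  · refine lt_of_le_of_lt ?_ (hsum.trans ENNReal.one_lt_top)
    have hm : ∀ k : ℕ, AEMeasurable (fun x => (δ k : ℝ≥0∞) *
        (Metric.ball (0 : Eucl n) ((k : ℝ) + 1)).indicator 1 x) volume := fun k =>
      ((measurable_one.indicator Metric.isOpen_ball.measurableSet).const_mul _).aemeasurable
    calc associate N (fun x => ‖((δ ⌊‖x‖⌋₊ : ℝ≥0) : ℝ)‖ₑ)
        ≤ associate N (fun x => ∑' k : ℕ, (δ k : ℝ≥0∞) *
            (Metric.ball (0 : Eucl n) ((k : ℝ) + 1)).indicator 1 x) := by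
          refine associate_mono_ae (Eventually.of_forall fun x => ?_)
          refine le_trans (le_of_eq ?_) (ENNReal.le_tsum ⌊‖x‖⌋₊)
          have : x ∈ Metric.ball (0 : Eucl n) ((⌊‖x‖⌋₊ : ℝ) + 1) := by
            simpa using Nat.lt_floor_add_one ‖x‖
          simp [this]
      _ ≤ _ := by
          refine (associate_tsum_le hm).trans (le_of_eq ?_)
          congr 1 with k
          rw [associate_const_mul, mul_comm]

/-- Uniform approximation of bounded measurable functions by simple functions. -/
lemma exists_simpleFunc_norm_sub_le {α : Type*} [MeasurableSpace α] {s : α → 𝕜}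
    (hs : Measurable s) {M : ℝ} (hM : ∀ x, ‖s x‖ ≤ M) {ε : ℝ} (hε : 0 < ε) :
    ∃ t : SimpleFunc α 𝕜, ∀ x, ‖s x - t x‖ ≤ ε := by
  -- round to the nearest point of a finite `ε`-net of the ball of radius `M`
  set e := TopologicalSpace.denseSeq 𝕜
  have hcover : Metric.closedBall (0 : 𝕜) M ⊆ ⋃ k, Metric.ball (e k) ε := by
    intro y _
    obtain ⟨k, hk⟩ := (TopologicalSpace.denseRange_denseSeq 𝕜).exists_dist_lt y hε
    exact mem_iUnion.2 ⟨k, hk⟩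
  obtain ⟨t, ht⟩ := (isCompact_closedBall (0 : 𝕜) M).elim_finite_subcover _
    (fun k => Metric.isOpen_ball) hcover
  refine ⟨(SimpleFunc.nearestPt e (t.sup id)).comp s hs, fun x => ?_⟩
  have hx := ht (show s x ∈ Metric.closedBall (0 : 𝕜) M by simpa using hM x)
  simp only [mem_iUnion, Metric.mem_ball, exists_prop] at hx
  obtain ⟨k, hk, hkx⟩ := hx
  have h1 := SimpleFunc.edist_nearestPt_le e (s x) (Finset.le_sup (f := id) hk)
  rw [edist_dist, edist_dist, ENNReal.ofReal_le_ofReal_iff dist_nonneg] at h1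
  rw [SimpleFunc.coe_comp, Function.comp_apply, ← dist_eq_norm, dist_comm]
  rw [dist_comm] at hkx
  exact h1.trans hkx.le

/-- Bounded functionals on `X'(Ω)` that come from test functions are represented by elements of
`X(Ω)`, if test functions are dense in `X'(Ω)` and its norm is absolutely continuous. -/
theorem exists_representation (hN : IsBallBanachNorm N) (hΩ : IsOpen Ω)
    (hdense : TestDense 𝕜 (associate N) Ω) (hac : HasACNormOn 𝕜 (associate N) Ω)
    (L : (Eucl n → 𝕜) → 𝕜) (A : ℝ≥0)
    (hadd : ∀ φ ψ, IsTest Ω φ → IsTest Ω ψ → L (fun x => φ x + ψ x) = L φ + L ψ)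
    (hmul : ∀ (c : 𝕜) φ, IsTest Ω φ → L (fun x => c * φ x) = c * L φ)
    (hbound : ∀ φ, IsTest Ω φ → ‖L φ‖ₑ ≤ A * assocNorm N Ω φ) :
    ∃ g : Eucl n → 𝕜, AEStronglyMeasurable g (volume.restrict Ω) ∧
      (∀ R : ℝ, IntegrableOn g (Metric.ball 0 R) (volume.restrict Ω)) ∧
      (∀ φ, IsTest Ω φ → L φ = ∫ x in Ω, g x * φ x) ∧
      normOn N Ω (fun x => ‖g x‖ₑ) ≤ A := by
  have hΩm := hΩ.measurableSet
  obtain ⟨T, hTadd, hTmul, hTb, hTL⟩ := exists_extension hΩm hdense L A hadd hmul hbound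
  obtain ⟨w, hwm, hw0, hwloc, hwfin⟩ := exists_weight hN
  set W : Eucl n → 𝕜 := fun x => (w x : 𝕜) with hW
  have hWm : Measurable W := RCLike.continuous_ofReal.measurable.comp hwm
  have hWfin : assocNorm N Ω W < ∞ := by
    refine lt_of_le_of_lt (associate_mono_ae (Eventually.of_forall fun x => ?_)) hwfin
    by_cases hx : x ∈ Ω
    · rw [indicator_of_mem hx, ← ofReal_norm, ← ofReal_norm, RCLike.norm_ofReal,
        Real.norm_eq_abs]
    · simp [hx]
  have hbdd : ∀ {s : Eucl n → 𝕜}, Measurable s → ∀ {M : ℝ}, (∀ x, ‖s x‖ ≤ M) →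
      MemOn (associate N) Ω (fun x => W x * s x) ∧
      assocNorm N Ω (fun x => W x * s x) ≤ ENNReal.ofReal M * assocNorm N Ω W := by
    intro s hs M hM
    have hM0 : 0 ≤ M := (norm_nonneg _).trans (hM 0)
    have h1 : assocNorm N Ω (fun x => W x * s x) ≤ ENNReal.ofReal M * assocNorm N Ω W := by
      have := assocNorm_const_mul (N := N) (Ω := Ω) (M : 𝕜) W
      rw [← ofReal_norm (M : 𝕜), RCLike.norm_ofReal, abs_of_nonneg hM0] at this
      rw [← this]
      refine assocNorm_mono_ae hΩm (Eventually.of_forall fun x => ?_)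
      rw [norm_mul, norm_mul, RCLike.norm_ofReal M, abs_of_nonneg hM0, mul_comm]
      gcongr
      exact hM x
    refine ⟨(memOn_associate_iff hΩm).2 ⟨(hWm.mul hs).aestronglyMeasurable, ?_⟩, h1⟩
    exact h1.trans_lt (ENNReal.mul_lt_top (by simp) hWfin)
  have hind : ∀ E : Set (Eucl n), MeasurableSet E →
      E.indicator W = fun x => W x * E.indicator (fun _ => (1 : 𝕜)) x := by
    intro E _
    ext x
    by_cases hx : x ∈ E <;> simp [hx]
  have hindb : ∀ (E : Set (Eucl n)) (x), ‖E.indicator (fun _ => (1 : 𝕜)) x‖ ≤ 1 := by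
    intro E x
    by_cases hx : x ∈ E <;> simp [hx]
  have hindm : ∀ E : Set (Eucl n), MeasurableSet E → MemOn (associate N) Ω (E.indicator W) := by
    intro E hE
    rw [hind E hE]
    exact (hbdd (measurable_const.indicator hE) (hindb E)).1
  -- integrate the extended functional against the weight to get a set function
  obtain ⟨g₁, hg₁, hg₁T⟩ := exists_integrable_forall_eq_setIntegral (volume.restrict Ω)
    (fun E => T (E.indicator W)) (fun E => A * assocNorm N Ω (E.indicator W))
    (by
      intro E F hE hF hEF
      rw [indicator_union_of_disjoint hEF]
      exact hTadd _ _ (hindm E hE) (hindm F hF))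
    (fun E hE => hTb _ (hindm E hE))
    (by
      intro E F hEF
      dsimp only
      gcongr
      refine assocNorm_mono_ae hΩm (Eventually.of_forall fun x => ?_)
      exact norm_indicator_le_of_subset hEF _ _)
    (by
      intro E hE hanti hinter
      have h1 := hac W ((memOn_associate_iff hΩm).2 ⟨hWm.aestronglyMeasurable, hWfin⟩)
        (fun k => E k ∩ Ω) (fun k => inter_subset_right)
        (fun k => ((hE k).inter hΩm).nullMeasurableSet) (by
          refine Eventually.of_forall fun x => ?_
          have hx : x ∉ ⋂ k, E k := by simp [hinter]
          simp only [mem_iInter, not_forall] at hx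
          obtain ⟨j, hj⟩ := hx
          refine tendsto_const_nhds.congr' ?_
          filter_upwards [eventually_ge_atTop j] with k hk
          have : x ∉ E k ∩ Ω := fun h => hj (hanti hk h.1)
          simp [this])
      have h2 := ENNReal.Tendsto.const_mul (a := (A : ℝ≥0∞)) h1 (Or.inr (by simp))
      rw [mul_zero] at h2
      refine h2.congr fun k => ?_
      congr 1
      rw [normOn_associate_enorm hΩm
        (hWm.indicator ((hE k).inter hΩm)).aestronglyMeasurable]
      refine associate_congr_ae (Eventually.of_forall fun x => ?_)
      by_cases hx : x ∈ Ω <;> by_cases hx' : x ∈ E k <;> simp [hx, hx'])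
    (by
      intro E hE h0
      rw [← enorm_eq_zero, ← nonpos_iff_eq_zero]
      refine (hTb _ (hindm E hE)).trans (le_of_eq ?_)
      have : assocNorm N Ω (E.indicator W) = 0 := by
        rw [← associate_zero (N := N)]
        refine associate_congr_ae ?_
        rw [Measure.restrict_apply hE] at h0
        filter_upwards [measure_eq_zero_iff_ae_notMem.1 h0] with x hx
        by_cases hxΩ : x ∈ Ω
        · have : x ∉ E := fun h => hx ⟨h, hxΩ⟩
          simp [this]
        · simp [hxΩ]
      rw [this, mul_zero])
  set g₀ := hg₁.1.mk g₁
  have hg₀m : Measurable g₀ := hg₁.1.stronglyMeasurable_mk.measurable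
  have hg₀ : Integrable g₀ (volume.restrict Ω) := hg₁.congr hg₁.1.ae_eq_mk
  have hg₀T : ∀ E, MeasurableSet E → T (E.indicator W) = ∫ x in E, g₀ x ∂(volume.restrict Ω) :=
    fun E hE => (hg₁T E hE).trans (integral_congr_ae (ae_restrict_of_ae hg₁.1.ae_eq_mk))
  have hg₀s : ∀ {s : Eucl n → 𝕜}, Measurable s → ∀ {M : ℝ}, (∀ x, ‖s x‖ ≤ M) →
      Integrable (fun x => g₀ x * s x) (volume.restrict Ω) := fun hs _ hM =>
    hg₀.mul_bdd hs.aestronglyMeasurable (Eventually.of_forall hM)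
  -- the representation passes from indicators to simple functions and to bounded functions
  have hsimple : ∀ t : SimpleFunc (Eucl n) 𝕜, T (fun x => W x * t x) = ∫ x in Ω, g₀ x * t x := by
    intro t
    induction t using SimpleFunc.induction with
    | const c hE =>
      rename_i E
      have h1 : (fun x => W x * (SimpleFunc.piecewise E hE (SimpleFunc.const _ c)
          (SimpleFunc.const _ 0)) x) = fun x => c * E.indicator W x := by
        ext x
        by_cases hx : x ∈ E <;> simp [hx, mul_comm]
      have h2 : (fun x => g₀ x * (SimpleFunc.piecewise E hE (SimpleFunc.const _ c)
          (SimpleFunc.const _ 0)) x) = fun x => c * E.indicator g₀ x := by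
        ext x
        by_cases hx : x ∈ E <;> simp [hx, mul_comm]
      rw [h1, h2, hTmul c _ (hindm E hE), integral_const_mul, integral_indicator hE, hg₀T E hE]
    | @add s t hdisj hs ht =>
      obtain ⟨Ms, hMs⟩ := s.exists_forall_norm_le
      obtain ⟨Mt, hMt⟩ := t.exists_forall_norm_le
      simp only [SimpleFunc.coe_add, Pi.add_apply, mul_add]
      rw [hTadd _ _ (hbdd s.measurable hMs).1 (hbdd t.measurable hMt).1, hs, ht,
        ← integral_add (hg₀s s.measurable hMs) (hg₀s t.measurable hMt)]
  have hmeas : ∀ s : Eucl n → 𝕜, Measurable s → ∀ M : ℝ, (∀ x, ‖s x‖ ≤ M) →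
      T (fun x => W x * s x) = ∫ x in Ω, g₀ x * s x := by
    intro s hs M hM
    set D : ℝ := (A * assocNorm N Ω W).toReal + ∫ x in Ω, ‖g₀ x‖ with hD
    have hAW : A * assocNorm N Ω W ≠ ∞ := ENNReal.mul_ne_top (by simp) hWfin.ne
    have hD0 : 0 ≤ D := by positivity
    rw [← sub_eq_zero, ← norm_le_zero_iff]
    refine le_of_forall_pos_le_add fun ε hε => ?_
    have hε' : 0 < ε / (D + 1) := by positivity
    obtain ⟨t, ht⟩ := exists_simpleFunc_norm_sub_le hs hM hε'
    obtain ⟨Mt, hMt⟩ := t.exists_forall_norm_le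
    have hst : Measurable fun x => s x - t x := hs.sub t.measurable
    have e1 : T (fun x => W x * s x) = T (fun x => W x * (s x - t x)) + ∫ x in Ω, g₀ x * t x := by
      rw [← hsimple, ← hTadd _ _ (hbdd hst ht).1 (hbdd t.measurable hMt).1]
      congr 1 with x
      ring
    have e2 : ∫ x in Ω, g₀ x * s x = (∫ x in Ω, g₀ x * (s x - t x)) + ∫ x in Ω, g₀ x * t x := by
      rw [← integral_add (hg₀s hst ht) (hg₀s t.measurable hMt)]
      congr 1 with x
      ring
    have e3 : ‖T (fun x => W x * (s x - t x))‖ ≤ (A * assocNorm N Ω W).toReal * (ε / (D + 1)) := by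
      have := (hTb _ (hbdd hst ht).1).trans (mul_le_mul_right (hbdd hst ht).2 (A : ℝ≥0∞))
      rw [← toReal_enorm]
      refine (ENNReal.toReal_mono ?_ this).trans (le_of_eq ?_)
      · exact ENNReal.mul_ne_top (by simp) (ENNReal.mul_ne_top (by simp) hWfin.ne)
      · rw [mul_left_comm, ENNReal.toReal_mul, ENNReal.toReal_ofReal hε'.le, mul_comm]
    have e4 : ‖∫ x in Ω, g₀ x * (s x - t x)‖ ≤ (∫ x in Ω, ‖g₀ x‖) * (ε / (D + 1)) := by
      rw [← integral_mul_const]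
      refine norm_integral_le_of_norm_le (hg₀.norm.mul_const _) (Eventually.of_forall fun x => ?_)
      rw [norm_mul]
      gcongr
      exact ht x
    rw [e1, e2, add_sub_add_right_eq_sub, zero_add]
    calc _ ≤ _ := norm_sub_le _ _
      _ ≤ _ := add_le_add e3 e4
      _ = D * (ε / (D + 1)) := by rw [hD]; ring
      _ ≤ (D + 1) * (ε / (D + 1)) := by gcongr; linarith
      _ = ε := by field_simp
  have hW0 : ∀ x, W x ≠ 0 := fun x => by simpa [hW] using (hw0 x).ne'
  have hWn : ∀ x, ‖W x‖ = w x := fun x => by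
    rw [hW, RCLike.norm_ofReal, abs_of_pos (hw0 x)]
  set g : Eucl n → 𝕜 := fun x => g₀ x / W x with hg
  have hgm : Measurable g := hg₀m.div hWm
  refine ⟨g, hgm.aestronglyMeasurable, ?_, ?_, ?_⟩
  · intro R
    obtain ⟨c, hc, hcw⟩ := hwloc R
    refine Integrable.mono' (g := fun x => c⁻¹ * ‖g₀ x‖) (hg₀.norm.const_mul _).integrableOn
      hgm.aestronglyMeasurable ?_
    filter_upwards [ae_restrict_mem Metric.isOpen_ball.measurableSet] with x hx
    rw [hg, norm_div, hWn, div_eq_inv_mul]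
    have := hcw x hx
    gcongr
  · intro φ hφ
    obtain ⟨R, hR⟩ := hφ.compact.isBounded.subset_ball (0 : Eucl n)
    obtain ⟨c, hc, hcw⟩ := hwloc R
    obtain ⟨B, hB⟩ := hφ.compact.exists_bound_of_continuous hφ.continuous
    have hs : Measurable fun x => φ x / W x := hφ.continuous.measurable.div hWm
    have hb : ∀ x, ‖φ x / W x‖ ≤ B / c := by
      intro x
      by_cases hx : x ∈ tsupport φ
      · rw [norm_div, hWn]
        have := hcw x (hR hx)
        exact div_le_div₀ ((norm_nonneg _).trans (hB x)) (hB x) hc this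
      · rw [image_eq_zero_of_notMem_tsupport hx, zero_div, norm_zero]
        exact div_nonneg ((norm_nonneg _).trans (hB x)) hc.le
    have h1 : (fun x => W x * (φ x / W x)) = φ := by
      ext x
      rw [mul_div_cancel₀ _ (hW0 x)]
    have h2 := hmeas _ hs _ hb
    have h3 := (hbdd hs hb).1
    rw [h1] at h2 h3
    rw [← hTL φ hφ h3, h2]
    congr 1 with x
    rw [hg]
    ring
  · rw [hN.normOn_eq hΩm hgm.enorm.aemeasurable]
    refine norm_le_of_forall_lintegral_mul_le hN (hgm.enorm.indicator hΩm).aemeasurable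
      fun ψ hψ => ?_
    set ψ' := hψ.mk ψ
    have hψ' : Measurable ψ' := hψ.measurable_mk
    -- test with the truncations `min ψ (k w)` of `ψ`, turned by the phase of `g₀`
    set ψk : ℕ → Eucl n → ℝ≥0∞ := fun k x => min (ψ' x) (ENNReal.ofReal (k * w x)) with hψk
    have hψkm : ∀ k, Measurable (ψk k) := fun k =>
      hψ'.min (hwm.const_mul _).ennreal_ofReal
    have hk : ∀ k, ∫⁻ x, Ω.indicator (fun x => ‖g x‖ₑ) x * ψk k x ≤ A * associate N ψ := by
      intro k
      set σ : Eucl n → 𝕜 := fun x => starRingEnd 𝕜 (g₀ x) / (‖g₀ x‖ : 𝕜) with hσ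
      have hσm : Measurable σ := (RCLike.continuous_conj.measurable.comp hg₀m).div
        (RCLike.continuous_ofReal.measurable.comp hg₀m.norm)
      have hσ1 : ∀ x, ‖σ x‖ ≤ 1 := fun x => by
        rw [hσ, norm_div, RCLike.norm_conj, RCLike.norm_ofReal, abs_norm]
        exact div_self_le_one _
      have hψktop : ∀ x, ψk k x ≠ ∞ := fun x =>
        ((min_le_right _ _).trans_lt ENNReal.ofReal_lt_top).ne
      have hψkw : ∀ x, (ψk k x).toReal ≤ k * w x := fun x => by
        have h0 : 0 ≤ k * w x := mul_nonneg (by positivity) (hw0 x).le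
        exact ENNReal.toReal_le_of_le_ofReal h0 (min_le_right _ _)
      set s : Eucl n → 𝕜 := fun x => σ x * ((ψk k x).toReal / w x : ℝ) with hs
      have hsm : Measurable s := hσm.mul (RCLike.continuous_ofReal.measurable.comp
        ((hψkm k).ennreal_toReal.div hwm))
      have hsb : ∀ x, ‖s x‖ ≤ k := fun x => by
        rw [hs, norm_mul, RCLike.norm_ofReal,
          abs_of_nonneg (div_nonneg ENNReal.toReal_nonneg (hw0 x).le)]
        refine (mul_le_of_le_one_left (div_nonneg ENNReal.toReal_nonneg (hw0 x).le)
          (hσ1 x)).trans ?_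
        rw [div_le_iff₀ (hw0 x)]
        exact hψkw x
      have hval : ∀ x, g₀ x * s x = ((‖g x‖ * (ψk k x).toReal : ℝ) : 𝕜) := by
        intro x
        have h1 : g₀ x * σ x = (‖g₀ x‖ : 𝕜) := by
          rcases eq_or_ne (g₀ x) 0 with h0 | h0
          · simp [h0]
          · have hne : (‖g₀ x‖ : 𝕜) ≠ 0 := by simpa using h0
            rw [hσ, mul_div_assoc', RCLike.mul_conj, div_eq_iff hne, sq]
        rw [hs, ← mul_assoc, h1, hg, norm_div, hWn]
        push_cast
        ring
      have hI := hg₀s hsm hsb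
      have h1 := hmeas s hsm _ hsb
      have h2 := hTb _ (hbdd hsm hsb).1
      rw [h1] at h2
      have h3 : ‖∫ x in Ω, g₀ x * s x‖ₑ = ∫⁻ x in Ω, ‖g x‖ₑ * ψk k x := by
        have hI' : Integrable (fun x => ‖g x‖ * (ψk k x).toReal) (volume.restrict Ω) := by
          refine hI.norm.congr (Eventually.of_forall fun x => ?_)
          dsimp only
          rw [hval, RCLike.norm_ofReal, abs_of_nonneg (by positivity)]
        simp_rw [hval]
        rw [integral_ofReal, ← ofReal_norm, RCLike.norm_ofReal,
          abs_of_nonneg (integral_nonneg fun x => by positivity),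
          ofReal_integral_eq_lintegral_ofReal hI' (Eventually.of_forall fun x => by positivity)]
        congr 1 with x
        rw [ENNReal.ofReal_mul (norm_nonneg _), ofReal_norm, ENNReal.ofReal_toReal (hψktop x)]
      have h4 : ∫⁻ x, Ω.indicator (fun x => ‖g x‖ₑ) x * ψk k x =
          ∫⁻ x in Ω, ‖g x‖ₑ * ψk k x := by
        rw [← lintegral_indicator hΩm]
        congr 1 with x
        by_cases hx : x ∈ Ω <;> simp [hx]
      rw [h4, ← h3]
      refine h2.trans ?_
      gcongr
      refine associate_mono_ae ?_
      filter_upwards [hψ.ae_eq_mk] with x hx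
      by_cases hxΩ : x ∈ Ω
      · rw [indicator_of_mem hxΩ, hx]
        refine le_trans ?_ (min_le_left (ψ' x) (ENNReal.ofReal (k * w x)))
        have : ‖W x * s x‖ ≤ (ψk k x).toReal := by
          rw [norm_mul, hWn, hs, norm_mul, RCLike.norm_ofReal,
            abs_of_nonneg (div_nonneg ENNReal.toReal_nonneg (hw0 x).le)]
          calc w x * (‖σ x‖ * ((ψk k x).toReal / w x))
              ≤ w x * (1 * ((ψk k x).toReal / w x)) := by
                have := (hw0 x).le
                gcongr
                exact hσ1 x
            _ = (ψk k x).toReal := by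
                have := (hw0 x).ne'
                field_simp
        rw [← ofReal_norm]
        exact (ENNReal.ofReal_le_ofReal this).trans (le_of_eq (ENNReal.ofReal_toReal (hψktop x)))
      · simp [hxΩ]
    have hlim : Tendsto (fun k => ∫⁻ x, Ω.indicator (fun x => ‖g x‖ₑ) x * ψk k x) atTop
        (𝓝 (∫⁻ x, Ω.indicator (fun x => ‖g x‖ₑ) x * ψ' x)) := by
      refine lintegral_tendsto_of_tendsto_of_monotone
        (fun k => ((hgm.enorm.indicator hΩm).mul (hψkm k)).aemeasurable)
        (Eventually.of_forall fun x a b hab => ?_) (Eventually.of_forall fun x => ?_)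
      · have h1 : (a : ℝ) ≤ b := by exact_mod_cast hab
        have h2 := (hw0 x).le
        simp only [hψk]
        gcongr
      · refine ENNReal.Tendsto.const_mul ?_ (Or.inr ?_)
        · have h1 : Tendsto (fun k : ℕ => ENNReal.ofReal (k * w x)) atTop (𝓝 ∞) :=
            ENNReal.tendsto_ofReal_atTop.comp
              (tendsto_natCast_atTop_atTop.atTop_mul_const (hw0 x))
          have h2 : Tendsto (fun k : ℕ => min (ψ' x) (ENNReal.ofReal (k * w x))) atTop
            (𝓝 (min (ψ' x) ∞)) := tendsto_const_nhds.min h1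
          rwa [min_eq_left le_top] at h2
        · by_cases hx : x ∈ Ω <;> simp [hx]
    refine le_trans (le_of_eq (lintegral_congr_ae ?_)) (le_of_tendsto' hlim hk)
    filter_upwards [hψ.ae_eq_mk] with x hx
    rw [hx]

end

/-! ### Radial measures -/

/-- Integration of radial functions in polar coordinates, for the Lebesgue integral. -/
lemma lintegral_fun_norm_addHaar {E : Type*} [NormedAddCommGroup E] [NormedSpace ℝ E]
    [Nontrivial E] [FiniteDimensional ℝ E] [MeasurableSpace E] [BorelSpace E] (μ : Measure E)
    [μ.IsAddHaarMeasure] {g : ℝ → ℝ≥0∞} (hg : Measurable g) :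
    ∫⁻ x, g ‖x‖ ∂μ = μ.toSphere univ *
      ∫⁻ r in Ioi (0 : ℝ), ENNReal.ofReal (r ^ (Module.finrank ℝ E - 1)) * g r := by
  have hmp := μ.measurePreserving_homeomorphUnitSphereProd
  have hg1 : Measurable fun r : Ioi (0 : ℝ) => g r.1 := hg.comp measurable_subtype_coe
  have hg2 : Measurable fun z : Metric.sphere (0 : E) 1 × Ioi (0 : ℝ) => g z.2.1 :=
    hg1.comp measurable_snd
  calc ∫⁻ x, g ‖x‖ ∂μ = ∫⁻ x in ({(0 : E)}ᶜ : Set E), g ‖x‖ ∂μ := by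
        rw [restrict_compl_singleton]
    _ = ∫⁻ x : ({(0 : E)}ᶜ : Set E), g ‖x.1‖ ∂(μ.comap (↑)) :=
        (lintegral_subtype_comap (measurableSet_singleton _).compl fun x => g ‖x‖).symm
    _ = ∫⁻ z, g z.2.1 ∂(μ.toSphere.prod (Measure.volumeIoiPow (Module.finrank ℝ E - 1))) := by
        rw [← hmp.lintegral_comp hg2]
        simp only [homeomorphUnitSphereProd_apply_snd_coe]
    _ = μ.toSphere univ * ∫⁻ r, g r.1 ∂(Measure.volumeIoiPow (Module.finrank ℝ E - 1)) := by
        rw [lintegral_prod _ hg2.aemeasurable]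
        simp [mul_comm]
    _ = _ := by
        rw [Measure.volumeIoiPow, lintegral_withDensity_eq_lintegral_mul _ (by fun_prop) hg1,
          ← lintegral_subtype_comap measurableSet_Ioi]
        rfl

variable {n : ℕ}

/-- The measure on `ℝⁿ` with the radial density `g(|h|)`. -/
noncomputable def radialMeasure (n : ℕ) (g : ℝ → ℝ≥0∞) : Measure (Eucl n) :=
  volume.withDensity fun h => g ‖h‖

lemma lintegral_radialMeasure {g : ℝ → ℝ≥0∞} (hg : Measurable g) {F : Eucl n → ℝ≥0∞}
    (hF : AEMeasurable F volume) :
    ∫⁻ h, F h ∂(radialMeasure n g) = ∫⁻ h, g ‖h‖ * F h := by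
  have hg' : Measurable fun h : Eucl n => g ‖h‖ := hg.comp measurable_norm
  rw [radialMeasure, lintegral_withDensity_eq_lintegral_mul₀ hg'.aemeasurable hF]
  rfl

lemma radialMeasure_absolutelyContinuous (g : ℝ → ℝ≥0∞) :
    radialMeasure n g ≪ (volume : Measure (Eucl n)) :=
  withDensity_absolutelyContinuous _ _

lemma radialMeasure_univ (g : ℝ → ℝ≥0∞) : radialMeasure n g univ = ∫⁻ h : Eucl n, g ‖h‖ := by
  rw [radialMeasure, withDensity_apply _ .univ, Measure.restrict_univ]

lemma measurableEmbedding_isometryEquiv (e : Eucl n ≃ₗᵢ[ℝ] Eucl n) : MeasurableEmbedding e :=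
  e.toHomeomorph.measurableEmbedding

lemma measurePreserving_radialMeasure {g : ℝ → ℝ≥0∞} (hg : Measurable g)
    (e : Eucl n ≃ₗᵢ[ℝ] Eucl n) : MeasurePreserving e (radialMeasure n g) (radialMeasure n g) := by
  refine ⟨e.continuous.measurable, ?_⟩
  have hg' : Measurable fun h : Eucl n => g ‖h‖ := hg.comp measurable_norm
  ext s hs
  rw [Measure.map_apply e.continuous.measurable hs, radialMeasure,
    withDensity_apply _ (e.continuous.measurable hs), withDensity_apply _ hs,
    ← lintegral_indicator (e.continuous.measurable hs), ← lintegral_indicator hs,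
    ← e.measurePreserving.lintegral_comp (hg'.indicator hs)]
  congr 1 with x
  by_cases hx : e x ∈ s
  · rw [indicator_of_mem hx, indicator_of_mem (show x ∈ e ⁻¹' s from hx), e.norm_map]
  · rw [indicator_of_notMem hx, indicator_of_notMem (show x ∉ e ⁻¹' s from hx)]

lemma abs_coord_div_sq_le (j : Fin n) (h : Eucl n) : |h j / ‖h‖ ^ 2| ≤ ‖h‖⁻¹ := by
  rcases eq_or_ne h 0 with rfl | hh
  · simp
  · have h0 : 0 < ‖h‖ := norm_pos_iff.2 hh
    rw [abs_div, abs_of_pos (by positivity : 0 < ‖h‖ ^ 2), div_le_iff₀ (by positivity)]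
    have := PiLp.norm_apply_le h j
    rw [Real.norm_eq_abs] at this
    calc |h j| ≤ ‖h‖ := this
      _ = ‖h‖⁻¹ * ‖h‖ ^ 2 := by field_simp

lemma abs_coord_mul_div_sq_le (j k : Fin n) (h : Eucl n) : |h j / ‖h‖ ^ 2 * h k| ≤ 1 := by
  rcases eq_or_ne h 0 with rfl | hh
  · simp
  · have h0 : 0 < ‖h‖ := norm_pos_iff.2 hh
    rw [abs_mul]
    have := PiLp.norm_apply_le h k
    rw [Real.norm_eq_abs] at this
    calc _ ≤ ‖h‖⁻¹ * ‖h‖ := mul_le_mul (abs_coord_div_sq_le j h) this (abs_nonneg _) (by positivity)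
      _ = 1 := inv_mul_cancel₀ h0.ne'

lemma measurable_coord_div_sq (j : Fin n) : Measurable fun h : Eucl n => h j / ‖h‖ ^ 2 := by
  fun_prop

/-- By symmetry the second moments of the direction `h/|h|` under a radial measure form a multiple
of the identity matrix. -/
lemma integral_coord_mul_coord_radialMeasure {g : ℝ → ℝ≥0∞} (hg : Measurable g)
    (hfin : radialMeasure n g univ ≠ ∞) (j k : Fin n) :
    ∫ h, h j / ‖h‖ ^ 2 * h k ∂(radialMeasure n g) =
      if j = k then (radialMeasure n g univ).toReal / n else 0 := by
  classical
  have hn : n ≠ 0 := fun h => (h ▸ j).elim0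
  set κ := radialMeasure n g
  have : IsFiniteMeasure κ := ⟨lt_top_iff_ne_top.2 hfin⟩
  have hint : ∀ i : Fin n, Integrable (fun h : Eucl n => h i / ‖h‖ ^ 2 * h i) κ := fun i =>
    Integrable.of_bound ((measurable_coord_div_sq i).mul (by fun_prop)).aestronglyMeasurable 1
      (Eventually.of_forall fun h => abs_coord_mul_div_sq_le i i h)
  split_ifs with hjk
  · subst hjk
    -- all the diagonal moments agree, and they add up to the total mass
    have hall : ∀ i : Fin n, ∫ h, h i / ‖h‖ ^ 2 * h i ∂κ = ∫ h, h j / ‖h‖ ^ 2 * h j ∂κ := by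
      intro i
      -- permuting coordinates is an isometry
      have e := measurePreserving_radialMeasure hg
        (LinearIsometryEquiv.piLpCongrLeft 2 ℝ ℝ (Equiv.swap i j))
      rw [← e.integral_comp (measurableEmbedding_isometryEquiv _)]
      congr 1 with h
      rw [LinearIsometryEquiv.norm_map]
      simp [Equiv.piCongrLeft']
    have hsum : ∑ i : Fin n, ∫ h, h i / ‖h‖ ^ 2 * h i ∂κ = κ.real univ := by
      rw [← integral_finsetSum _ fun i _ => hint i]
      have h0 : ∀ᵐ h : Eucl n ∂κ, h ≠ 0 :=
        (radialMeasure_absolutelyContinuous g).ae_le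
          (show ∀ᵐ h : Eucl n ∂volume, h ≠ 0 by
            have : Nonempty (Fin n) := ⟨j⟩
            exact Measure.ae_ne volume 0)
      rw [integral_congr_ae (g := fun _ => (1 : ℝ)), integral_const, smul_eq_mul, mul_one]
      filter_upwards [h0] with h hh
      have h1 : ‖h‖ ^ 2 ≠ 0 := by simpa using hh
      calc ∑ i, h i / ‖h‖ ^ 2 * h i = (∑ i, h i ^ 2) / ‖h‖ ^ 2 := by
            rw [Finset.sum_div]
            congr 1 with i
            ring
        _ = 1 := by rw [← EuclideanSpace.real_norm_sq_eq, div_self h1]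
    rw [Finset.sum_congr rfl fun i _ => hall i] at hsum
    simp only [Finset.sum_const, Finset.card_univ, Fintype.card_fin, nsmul_eq_mul] at hsum
    rw [eq_div_iff (Nat.cast_ne_zero.2 hn), mul_comm, hsum]
    rfl
  · -- the reflection of the coordinate `j` reverses the sign
    have e := measurePreserving_radialMeasure hg (LinearIsometryEquiv.piLpCongrRight 2
      fun i : Fin n => if i = j then LinearIsometryEquiv.neg ℝ else LinearIsometryEquiv.refl ℝ ℝ)
    have h1 := e.integral_comp (measurableEmbedding_isometryEquiv _)
      (fun h : Eucl n => h j / ‖h‖ ^ 2 * h k)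
    have h2 : ∀ h : Eucl n, (LinearIsometryEquiv.piLpCongrRight 2
        fun i : Fin n => if i = j then LinearIsometryEquiv.neg ℝ
          else LinearIsometryEquiv.refl ℝ ℝ) h j = - h j := by
      intro h
      simp
    have h3 : ∀ h : Eucl n, (LinearIsometryEquiv.piLpCongrRight 2
        fun i : Fin n => if i = j then LinearIsometryEquiv.neg ℝ
          else LinearIsometryEquiv.refl ℝ ℝ) h k = h k := by
      intro h
      simp [Ne.symm hjk]
    simp only [LinearIsometryEquiv.norm_map, h2, h3] at h1
    simp only [neg_div, neg_mul, integral_neg] at h1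
    linarith

/-- The profile of a radial kernel, set to zero outside `(0,∞)`. -/
noncomputable def profile (r : ℝ → ℝ) : ℝ → ℝ≥0∞ := (Ioi 0).indicator fun t => ENNReal.ofReal (r t)

lemma measurable_profile {r : ℝ → ℝ} (hr : AntitoneOn r (Ioi 0)) : Measurable (profile r) := by
  have h1 : Antitone fun t : Ioi (0 : ℝ) => ENNReal.ofReal (r t) := fun a b hab =>
    ENNReal.ofReal_le_ofReal (hr a.2 b.2 hab)
  refine measurable_of_restrict_of_restrict_compl (s := Ioi (0 : ℝ)) measurableSet_Ioi ?_ ?_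
  · convert h1.measurable using 1
    ext t
    exact indicator_of_mem (f := fun t => ENNReal.ofReal (r t)) t.2
  · convert (measurable_const : Measurable fun _ : ((Ioi (0 : ℝ))ᶜ : Set ℝ) => (0 : ℝ≥0∞)) using 1
    ext t
    exact indicator_of_notMem t.2 fun t => ENNReal.ofReal (r t)

/-! ### Approximations of the identity and the expansion of correlations -/

section

variable {n : ℕ} {𝕜 : Type*} [RCLike 𝕜]

/-- The surface measure of the unit sphere of `ℝⁿ`. -/
noncomputable def sphereMass (n : ℕ) : ℝ≥0∞ := (volume : Measure (Eucl n)).toSphere univ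

lemma sphereMass_ne_zero (hn : 1 ≤ n) : sphereMass n ≠ 0 := by
  have : Nonempty (Fin n) := ⟨⟨0, hn⟩⟩
  exact fun h => Measure.toSphere_ne_zero (volume : Measure (Eucl n))
    (Measure.measure_univ_eq_zero.1 h)

lemma sphereMass_ne_top : sphereMass n ≠ ∞ := measure_ne_top _ _

lemma lintegral_profile_indicator (hn : 1 ≤ n) {r : ℝ → ℝ} (hr : AntitoneOn r (Ioi 0))
    {s : Set ℝ} (hs : MeasurableSet s) :
    ∫⁻ h : Eucl n, s.indicator (profile r) ‖h‖ = sphereMass n *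
      ∫⁻ t in Ioi (0 : ℝ) ∩ s, ENNReal.ofReal (r t * t ^ ((n : ℝ) - 1)) := by
  have : Nonempty (Fin n) := ⟨⟨0, hn⟩⟩
  rw [lintegral_fun_norm_addHaar _ ((measurable_profile hr).indicator hs), sphereMass,
    inter_comm, ← setLIntegral_indicator hs]
  congr 1
  refine setLIntegral_congr_fun measurableSet_Ioi fun t (ht : 0 < t) => ?_
  by_cases hts : t ∈ s
  · have h1 : t ^ ((n : ℝ) - 1) = t ^ (n - 1) := by
      rw [← Real.rpow_natCast, Nat.cast_sub hn, Nat.cast_one]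
    rw [indicator_of_mem hts, indicator_of_mem hts, profile, indicator_of_mem (mem_Ioi.2 ht),
      finrank_euclideanSpace_fin, h1, mul_comm (r t), ENNReal.ofReal_mul (by positivity)]
  · simp [hts]

lemma lintegral_profile (hn : 1 ≤ n) {r : ℝ → ℝ} (hr : AntitoneOn r (Ioi 0))
    (h1 : ∫⁻ t in Ioi (0 : ℝ), ENNReal.ofReal (r t * t ^ ((n : ℝ) - 1)) = 1) :
    ∫⁻ h : Eucl n, profile r ‖h‖ = sphereMass n := by
  have := lintegral_profile_indicator hn hr .univ
  simpa [h1] using this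

lemma lintegral_profile_tail (hn : 1 ≤ n) {r : ℝ → ℝ} (hr : AntitoneOn r (Ioi 0)) {δ : ℝ}
    (hδ : 0 < δ) :
    ∫⁻ h : Eucl n, (Ici δ).indicator (profile r) ‖h‖ = sphereMass n *
      ∫⁻ t in Ioi δ, ENNReal.ofReal (r t * t ^ ((n : ℝ) - 1)) := by
  rw [lintegral_profile_indicator hn hr measurableSet_Ici]
  have : Ioi (0 : ℝ) ∩ Ici δ = Ici δ := inter_eq_right.2 fun t ht => hδ.trans_le ht
  rw [this, ← restrict_Ioi_eq_restrict_Ici]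

/-- The radial measure with profile `r` cut off at radius `δ`. -/
noncomputable def cutMeasure (n : ℕ) (r : ℝ → ℝ) (δ : ℝ) : Measure (Eucl n) :=
  radialMeasure n ((Iio δ).indicator (profile r))

lemma cutMeasure_univ_add_tail {r : ℝ → ℝ} (hr : AntitoneOn r (Ioi 0)) (δ : ℝ) :
    cutMeasure n r δ univ + ∫⁻ h : Eucl n, (Ici δ).indicator (profile r) ‖h‖ =
      ∫⁻ h : Eucl n, profile r ‖h‖ := by
  have hm : Measurable fun h : Eucl n => (Iio δ).indicator (profile r) ‖h‖ :=
    ((measurable_profile hr).indicator measurableSet_Iio).comp measurable_norm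
  rw [cutMeasure, radialMeasure_univ, ← lintegral_add_left hm]
  congr 1 with h
  by_cases hh : ‖h‖ < δ
  · simp [hh, hh.not_ge]
  · simp [hh, not_lt.1 hh]

section Limits

variable {ν₀ : ℝ} {ρ : ℝ → ℝ → ℝ}

lemma eventually_mem_Ioo (hν₀ : 0 < ν₀) : ∀ᶠ ν in 𝓝[>] (0 : ℝ), ν ∈ Ioo 0 ν₀ :=
  Ioo_mem_nhdsGT hν₀

lemma tendsto_cutMeasure_univ (hn : 1 ≤ n) (hν₀ : 0 < ν₀) (hρ : IsRDATI n ν₀ ρ) {δ : ℝ}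
    (hδ : 0 < δ) :
    Tendsto (fun ν => cutMeasure n (ρ ν) δ univ) (𝓝[>] 0) (𝓝 (sphereMass n)) := by
  have h1 : Tendsto (fun ν => sphereMass n - sphereMass n *
      ∫⁻ t in Ioi δ, ENNReal.ofReal (ρ ν t * t ^ ((n : ℝ) - 1))) (𝓝[>] 0)
      (𝓝 (sphereMass n - sphereMass n * 0)) :=
    ENNReal.Tendsto.sub tendsto_const_nhds
      (ENNReal.Tendsto.const_mul (hρ.tail δ hδ) (Or.inr sphereMass_ne_top))
      (Or.inl sphereMass_ne_top)
  rw [mul_zero, tsub_zero] at h1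
  refine h1.congr' ?_
  filter_upwards [eventually_mem_Ioo hν₀] with ν hν
  have h2 := cutMeasure_univ_add_tail (n := n) (hρ.antitone ν hν) δ
  rw [lintegral_profile_tail hn (hρ.antitone ν hν) hδ,
    lintegral_profile hn (hρ.antitone ν hν) (hρ.integral_eq_one ν hν)] at h2
  refine (ENNReal.eq_sub_of_add_eq ?_ h2).symm
  exact ne_top_of_le_ne_top sphereMass_ne_top (le_add_self.trans_eq h2)

lemma cutMeasure_univ_le (hn : 1 ≤ n) (hρ : IsRDATI n ν₀ ρ) {ν : ℝ} (hν : ν ∈ Ioo 0 ν₀) (δ : ℝ) :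
    cutMeasure n (ρ ν) δ univ ≤ sphereMass n := by
  rw [← lintegral_profile hn (hρ.antitone ν hν) (hρ.integral_eq_one ν hν),
    ← cutMeasure_univ_add_tail (hρ.antitone ν hν) δ]
  exact le_self_add

lemma lintegral_enorm_cutMeasure_le (hn : 1 ≤ n) (hρ : IsRDATI n ν₀ ρ) {ν : ℝ}
    (hν : ν ∈ Ioo 0 ν₀) (δ : ℝ) {η : ℝ} (hη : 0 < η) :
    ∫⁻ h, ‖h‖ₑ ∂(cutMeasure n (ρ ν) δ) ≤ ENNReal.ofReal η * sphereMass n +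
      ENNReal.ofReal δ * (sphereMass n *
        ∫⁻ t in Ioi η, ENNReal.ofReal (ρ ν t * t ^ ((n : ℝ) - 1))) := by
  have hm := measurable_profile (hρ.antitone ν hν)
  have hm1 : Measurable fun h : Eucl n => profile (ρ ν) ‖h‖ := hm.comp measurable_norm
  rw [cutMeasure, lintegral_radialMeasure (hm.indicator measurableSet_Iio) (by fun_prop),
    ← lintegral_profile_tail hn (hρ.antitone ν hν) hη,
    ← lintegral_profile hn (hρ.antitone ν hν) (hρ.integral_eq_one ν hν),
    ← lintegral_const_mul _ hm1, ← lintegral_const_mul' _ _ (by simp),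
    ← lintegral_add_left (hm1.const_mul _)]
  refine lintegral_mono fun h => ?_
  by_cases hδ : ‖h‖ < δ
  · rw [indicator_of_mem (mem_Iio.2 hδ), ← ofReal_norm, mul_comm]
    by_cases hη' : ‖h‖ < η
    · refine le_trans ?_ le_self_add
      gcongr
    · rw [indicator_of_mem (mem_Ici.2 (not_lt.1 hη'))]
      refine le_trans ?_ le_add_self
      gcongr
  · simp [hδ]

lemma tendsto_lintegral_enorm_cutMeasure (hn : 1 ≤ n) (hν₀ : 0 < ν₀) (hρ : IsRDATI n ν₀ ρ)
    (δ : ℝ) :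
    Tendsto (fun ν => ∫⁻ h, ‖h‖ₑ ∂(cutMeasure n (ρ ν) δ)) (𝓝[>] 0) (𝓝 0) := by
  rw [ENNReal.tendsto_nhds_zero]
  intro ε hε
  have hlim : Tendsto (fun η : ℝ => ENNReal.ofReal η * sphereMass n) (𝓝[>] 0) (𝓝 0) := by
    have h1 : Tendsto (fun η : ℝ => ENNReal.ofReal η) (𝓝[>] 0) (𝓝 (ENNReal.ofReal 0)) :=
      (ENNReal.continuous_ofReal.tendsto 0).mono_left nhdsWithin_le_nhds
    have := ENNReal.Tendsto.mul_const (b := sphereMass n) h1 (Or.inr sphereMass_ne_top)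
    simpa using this
  -- split the first moment at radius `η`
  obtain ⟨η, hη1, hη⟩ := ((ENNReal.tendsto_nhds_zero.1 hlim (ε / 2)
    (ENNReal.half_pos hε.ne')).and self_mem_nhdsWithin).exists
  have h2 : Tendsto (fun ν => ENNReal.ofReal δ * (sphereMass n *
      ∫⁻ t in Ioi η, ENNReal.ofReal (ρ ν t * t ^ ((n : ℝ) - 1)))) (𝓝[>] 0) (𝓝 0) := by
    have := ENNReal.Tendsto.const_mul (a := ENNReal.ofReal δ) (ENNReal.Tendsto.const_mul
      (hρ.tail η hη) (Or.inr (sphereMass_ne_top (n := n)))) (Or.inr ENNReal.ofReal_ne_top)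
    simpa using this
  filter_upwards [ENNReal.tendsto_nhds_zero.1 h2 (ε / 2) (ENNReal.half_pos hε.ne'),
    eventually_mem_Ioo hν₀] with ν hν1 hν
  calc _ ≤ _ := lintegral_enorm_cutMeasure_le hn hρ hν δ hη
    _ ≤ ε / 2 + ε / 2 := add_le_add hη1 hν1
    _ = ε := ENNReal.add_halves ε

end Limits

lemma IsTest.exists_taylor_bound {Ω : Set (Eucl n)} {φ : Eucl n → 𝕜} (hφ : IsTest Ω φ) :
    ∃ M : ℝ≥0, ∀ x h, ‖φ (x + h) - φ x - fderiv ℝ φ x h‖ ≤ M * ‖h‖ ^ 2 := by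
  have hd : ContDiff ℝ 1 (fderiv ℝ φ) := hφ.smooth.fderiv_right (by norm_cast)
  obtain ⟨M, hM⟩ := hd.lipschitzWith_of_hasCompactSupport (hφ.compact.fderiv ℝ) (by simp)
  refine ⟨M, fun x h => ?_⟩
  have := (convex_closedBall x ‖h‖).norm_image_sub_le_of_norm_fderiv_le' (𝕜 := ℝ) (f := φ)
    (φ := fderiv ℝ φ x) (C := M * ‖h‖) (x := x) (y := x + h)
    (fun y _ => hφ.smooth.differentiable (by simp) y)
    (fun y hy => by
      rw [← dist_eq_norm]
      refine (hM.dist_le_mul y x).trans ?_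
      gcongr
      exact hy) (by simp) (by simp)
  rw [add_sub_cancel_left] at this
  calc _ ≤ _ := this
    _ = _ := by ring

lemma IsTest.continuous_fderiv_apply {Ω : Set (Eucl n)} {φ : Eucl n → 𝕜} (hφ : IsTest Ω φ)
    (h : Eucl n) : Continuous fun x => fderiv ℝ φ x h :=
  (hφ.smooth.continuous_fderiv (by simp)).clm_apply continuous_const

lemma IsTest.integrable_mul {Ω : Set (Eucl n)} {φ : Eucl n → 𝕜} (hφ : IsTest Ω φ)
    {f : Eucl n → 𝕜} (hf : Integrable f volume) : Integrable (fun x => f x * φ x) volume := by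
  obtain ⟨B, hB⟩ := hφ.compact.exists_bound_of_continuous hφ.continuous
  exact hf.mul_bdd hφ.continuous.aestronglyMeasurable (Eventually.of_forall hB)

lemma IsTest.integrable_mul_fderiv {Ω : Set (Eucl n)} {φ : Eucl n → 𝕜} (hφ : IsTest Ω φ)
    {f : Eucl n → 𝕜} (hf : Integrable f volume) (h : Eucl n) :
    Integrable (fun x => f x * fderiv ℝ φ x h) volume := by
  have hc : HasCompactSupport fun x => fderiv ℝ φ x h :=
    (hφ.compact.fderiv ℝ).comp_left (g := fun L : Eucl n →L[ℝ] 𝕜 => L h) (by simp)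
  obtain ⟨B, hB⟩ := hc.exists_bound_of_continuous (hφ.continuous_fderiv_apply h)
  exact hf.mul_bdd (hφ.continuous_fderiv_apply h).aestronglyMeasurable (Eventually.of_forall hB)

/-- The first-order expansion at `0` of the correlation `h ↦ ∫ f (φ(· + h) - φ)`. -/
lemma IsTest.exists_correlation_bound {Ω : Set (Eucl n)} {φ : Eucl n → 𝕜} (hφ : IsTest Ω φ)
    {f : Eucl n → 𝕜} (hf : Integrable f volume) :
    ∃ M : ℝ≥0, ∀ h : Eucl n,
      ‖(∫ x, f x * (φ (x + h) - φ x)) -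
        ∑ k, (h k : 𝕜) * ∫ x, f x * fderiv ℝ φ x (EuclideanSpace.single k 1)‖ ≤ M * ‖h‖ ^ 2 := by
  obtain ⟨M, hM⟩ := hφ.exists_taylor_bound
  refine ⟨M * (∫ x, ‖f x‖).toNNReal, fun h => ?_⟩
  have hI : 0 ≤ ∫ x, ‖f x‖ := integral_nonneg fun _ => norm_nonneg _
  obtain ⟨B, hB⟩ := hφ.compact.exists_bound_of_continuous hφ.continuous
  have h1 : ∑ k, (h k : 𝕜) * ∫ x, f x * fderiv ℝ φ x (EuclideanSpace.single k 1) =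
      ∫ x, f x * fderiv ℝ φ x h := by
    simp_rw [← integral_const_mul]
    rw [← integral_finsetSum _ fun k _ => (hφ.integrable_mul_fderiv hf _).const_mul _]
    congr 1 with x
    have hh : h = ∑ k, h k • EuclideanSpace.single k (1 : ℝ) := by
      ext i
      simp [Pi.single_apply]
    conv_rhs => rw [hh, map_sum, Finset.mul_sum]
    refine Finset.sum_congr rfl fun k _ => ?_
    rw [map_smul, RCLike.real_smul_eq_coe_mul]
    ring
  have hi : Integrable (fun x => f x * (φ (x + h) - φ x)) volume := by
    refine hf.mul_bdd (c := B + B) ?_ (Eventually.of_forall fun x =>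
      (norm_sub_le _ _).trans (add_le_add (hB _) (hB _)))
    exact ((hφ.continuous.comp (continuous_add_const h)).sub hφ.continuous).aestronglyMeasurable
  rw [h1, ← integral_sub hi (hφ.integrable_mul_fderiv hf h)]
  push_cast
  rw [Real.coe_toNNReal _ hI]
  calc _ ≤ ∫ x, ‖f x‖ * (M * ‖h‖ ^ 2) := by
        refine norm_integral_le_of_norm_le (hf.norm.mul_const _) (Eventually.of_forall fun x => ?_)
        rw [← mul_sub, norm_mul]
        gcongr
        exact hM x h
    _ = _ := by rw [integral_mul_const]; ring

/-- The derivative of the correlation is recovered from its averages against a radial measure. -/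
lemma IsTest.enorm_integral_mul_fderiv_le {Ω : Set (Eucl n)} {φ : Eucl n → 𝕜} (hφ : IsTest Ω φ)
    {f : Eucl n → 𝕜} (hf : Integrable f volume) (j : Fin n) :
    ∃ M : ℝ≥0, ∀ g : ℝ → ℝ≥0∞, Measurable g → radialMeasure n g univ ≠ ∞ →
      ‖∫ x, f x * fderiv ℝ φ x (EuclideanSpace.single j 1)‖ₑ * (radialMeasure n g univ / n) ≤
        (∫⁻ h, ENNReal.ofReal ‖h‖⁻¹ * ‖∫ x, f x * (φ (x + h) - φ x)‖ₑ ∂(radialMeasure n g)) +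
        M * ∫⁻ h, ‖h‖ₑ ∂(radialMeasure n g) := by
  obtain ⟨M, hM⟩ := hφ.exists_correlation_bound hf
  refine ⟨M, fun g hg hfin => ?_⟩
  have hn : n ≠ 0 := fun h => (h ▸ j).elim0
  set κ := radialMeasure n g
  have : IsFiniteMeasure κ := ⟨lt_top_iff_ne_top.2 hfin⟩
  set a : Fin n → 𝕜 := fun k => ∫ x, f x * fderiv ℝ φ x (EuclideanSpace.single k 1)
  have hint : ∀ k : Fin n, Integrable (fun h : Eucl n => ((h j / ‖h‖ ^ 2 * h k : ℝ) : 𝕜) * a k) κ :=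
    fun k => ((Integrable.of_bound
      ((measurable_coord_div_sq j).mul (by fun_prop)).aestronglyMeasurable 1
      (Eventually.of_forall fun h => abs_coord_mul_div_sq_le j k h)).ofReal).mul_const _
  have h1 : ∫ h, ((h j / ‖h‖ ^ 2 : ℝ) : 𝕜) * ∑ k, (h k : 𝕜) * a k ∂κ =
      (((κ univ).toReal / n : ℝ) : 𝕜) * a j := by
    have : ∀ h : Eucl n, ((h j / ‖h‖ ^ 2 : ℝ) : 𝕜) * ∑ k, (h k : 𝕜) * a k =
        ∑ k, ((h j / ‖h‖ ^ 2 * h k : ℝ) : 𝕜) * a k := by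
      intro h
      rw [Finset.mul_sum]
      refine Finset.sum_congr rfl fun k _ => ?_
      push_cast
      ring
    simp_rw [this]
    rw [integral_finsetSum _ fun k _ => hint k]
    simp_rw [integral_mul_const, integral_ofReal]
    simp_rw [κ, integral_coord_mul_coord_radialMeasure hg hfin]
    rw [Finset.sum_eq_single j (fun k _ hk => by simp [hk.symm]) (by simp)]
    simp
  have h2 : ‖a j‖ₑ * (κ univ / n) =
      ‖∫ h, ((h j / ‖h‖ ^ 2 : ℝ) : 𝕜) * ∑ k, (h k : 𝕜) * a k ∂κ‖ₑ := by
    rw [h1, enorm_mul, mul_comm]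
    congr 1
    rw [← ofReal_norm, RCLike.norm_ofReal, abs_of_nonneg (by positivity),
      ENNReal.ofReal_div_of_pos (by positivity), ENNReal.ofReal_toReal hfin,
      ENNReal.ofReal_natCast]
  rw [h2]
  refine (enorm_integral_le_lintegral_enorm _).trans ?_
  rw [← lintegral_const_mul _ (by fun_prop), ← lintegral_add_right _ (by fun_prop)]
  refine lintegral_mono fun h => ?_
  -- at `h = 0` both sides vanish because `0⁻¹ = 0`
  have h3 : ‖((h j / ‖h‖ ^ 2 : ℝ) : 𝕜)‖ₑ ≤ ENNReal.ofReal ‖h‖⁻¹ := by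
    rw [← ofReal_norm, RCLike.norm_ofReal]
    exact ENNReal.ofReal_le_ofReal (abs_coord_div_sq_le j h)
  have h4 : ‖∑ k, (h k : 𝕜) * a k‖ₑ ≤
      ‖∫ x, f x * (φ (x + h) - φ x)‖ₑ + ENNReal.ofReal (M * ‖h‖ ^ 2) := by
    rw [← ofReal_norm, ← ofReal_norm, ← ENNReal.ofReal_add (norm_nonneg _) (by positivity)]
    refine ENNReal.ofReal_le_ofReal ?_
    have := hM h
    rw [norm_sub_rev] at this
    calc _ = ‖(∫ x, f x * (φ (x + h) - φ x)) + ((∑ k, (h k : 𝕜) * a k) -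
          ∫ x, f x * (φ (x + h) - φ x))‖ := by congr 1; ring
      _ ≤ _ := (norm_add_le _ _).trans (add_le_add le_rfl this)
  rw [enorm_mul]
  refine (mul_le_mul' h3 h4).trans ?_
  rw [mul_add]
  refine add_le_add le_rfl ?_
  rw [← ENNReal.ofReal_mul (by positivity), ← ofReal_norm, ← ENNReal.ofReal_coe_nnreal,
    ← ENNReal.ofReal_mul (by positivity)]
  refine ENNReal.ofReal_le_ofReal (le_of_eq ?_)
  rcases eq_or_ne h 0 with rfl | hh
  · simp
  · have : ‖h‖ ≠ 0 := norm_ne_zero_iff.2 hh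
    field_simp

end

/-! ### The distributional gradient is bounded on `X'(Ω)` -/

section

variable {n : ℕ} {𝕜 : Type*} [RCLike 𝕜] {Ω : Set (Eucl n)}

/-- Moving the difference from the test function to `f`. -/
lemma IsTest.correlation_eq {φ : Eucl n → 𝕜} (hφ : IsTest Ω φ) {f : Eucl n → 𝕜}
    (hf : Integrable f volume) (h : Eucl n) :
    ∫ x, f x * (φ (x + h) - φ x) = ∫ x, (f (x - h) - f x) * φ x := by
  obtain ⟨B, hB⟩ := hφ.compact.exists_bound_of_continuous hφ.continuous
  have i1 : Integrable (fun x => f x * φ (x + h)) volume :=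
    hf.mul_bdd (hφ.continuous.comp (continuous_add_const h)).aestronglyMeasurable
      (Eventually.of_forall fun x => hB (x + h))
  have i2 := hφ.integrable_mul hf
  have i3 : Integrable (fun x => f (x - h) * φ x) volume := hφ.integrable_mul (hf.comp_sub_right h)
  simp_rw [mul_sub, sub_mul]
  rw [integral_sub i1 i2, integral_sub i3 i2,
    ← integral_sub_right_eq_self (fun x => f x * φ (x + h)) h]
  simp

/-- The averaged correlation is dominated by the averaged first differences of `f`. -/
lemma IsTest.lintegral_correlation_le {φ : Eucl n → 𝕜} (hφ : IsTest Ω φ) {f : Eucl n → 𝕜}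
    (hf : Integrable f volume) (hfm : Measurable f) {g : ℝ → ℝ≥0∞} (hg : Measurable g) :
    ∫⁻ h, ENNReal.ofReal ‖h‖⁻¹ * ‖∫ x, f x * (φ (x + h) - φ x)‖ₑ ∂(radialMeasure n g) ≤
      ∫⁻ x, ‖φ x‖ₑ * ∫⁻ y, g ‖x - y‖ * (ENNReal.ofReal ‖x - y‖⁻¹ * ‖f x - f y‖ₑ) := by
  have hφm : Measurable φ := hφ.continuous.measurable
  have hmeas : Measurable fun z : Eucl n × Eucl n =>
      g ‖z.1‖ * (ENNReal.ofReal ‖z.1‖⁻¹ * (‖f (z.2 - z.1) - f z.2‖ₑ * ‖φ z.2‖ₑ)) := by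
    have h1 : Measurable fun z : Eucl n × Eucl n => g ‖z.1‖ :=
      hg.comp (measurable_norm.comp measurable_fst)
    have h2 : Measurable fun z : Eucl n × Eucl n => f (z.2 - z.1) - f z.2 :=
      (hfm.comp (measurable_snd.sub measurable_fst)).sub (hfm.comp measurable_snd)
    have h3 : Measurable fun z : Eucl n × Eucl n => ENNReal.ofReal ‖z.1‖⁻¹ :=
      (measurable_norm.comp measurable_fst).inv.ennreal_ofReal
    exact h1.mul (h3.mul (h2.enorm.mul (hφm.comp measurable_snd).enorm))
  have hB : Measurable fun h : Eucl n =>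
      ENNReal.ofReal ‖h‖⁻¹ * ∫⁻ x, ‖f (x - h) - f x‖ₑ * ‖φ x‖ₑ := by
    refine (by fun_prop : Measurable fun h : Eucl n => ENNReal.ofReal ‖h‖⁻¹).mul ?_
    have : Measurable fun z : Eucl n × Eucl n => ‖f (z.2 - z.1) - f z.2‖ₑ * ‖φ z.2‖ₑ :=
      ((hfm.comp (measurable_snd.sub measurable_fst)).sub (hfm.comp measurable_snd)).enorm.mul
        (hφm.comp measurable_snd).enorm
    exact this.lintegral_prod_right'
  calc _ ≤ ∫⁻ h, (ENNReal.ofReal ‖h‖⁻¹ * ∫⁻ x, ‖f (x - h) - f x‖ₑ * ‖φ x‖ₑ)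
          ∂(radialMeasure n g) := by
        refine lintegral_mono fun h => ?_
        gcongr
        rw [hφ.correlation_eq hf]
        refine (enorm_integral_le_lintegral_enorm _).trans (le_of_eq ?_)
        simp_rw [enorm_mul]
    _ = ∫⁻ h, ∫⁻ x, g ‖h‖ * (ENNReal.ofReal ‖h‖⁻¹ * (‖f (x - h) - f x‖ₑ * ‖φ x‖ₑ)) := by
        rw [lintegral_radialMeasure hg hB.aemeasurable]
        congr 1 with h
        have hm : Measurable fun x => ‖f (x - h) - f x‖ₑ * ‖φ x‖ₑ :=
          ((hfm.comp (measurable_sub_const h)).sub hfm).enorm.mul hφm.enorm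
        rw [lintegral_const_mul _ (hm.const_mul _), lintegral_const_mul _ hm]
    _ = ∫⁻ x, ∫⁻ h, g ‖h‖ * (ENNReal.ofReal ‖h‖⁻¹ * (‖f (x - h) - f x‖ₑ * ‖φ x‖ₑ)) :=
        lintegral_lintegral_swap hmeas.aemeasurable
    _ = _ := by
        congr 1 with x
        rw [← lintegral_sub_left_eq_self _ x, ← lintegral_const_mul' _ _ (by simp)]
        congr 1 with y
        rw [sub_sub_cancel, ← enorm_neg (f y - f x), neg_sub]
        ring

/-- Hölder's inequality: the first-order difference quotient is dominated by the one with
exponent `p`. -/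
lemma lintegral_profile_le_diffQuotient {f : Eucl n → 𝕜}
    (hf : AEStronglyMeasurable f (volume.restrict Ω)) {r : ℝ → ℝ} (hr : AntitoneOn r (Ioi 0))
    {p : ℝ} (hp : 1 ≤ p) (x : Eucl n) :
    ∫⁻ y in Ω, profile r ‖x - y‖ * (ENNReal.ofReal ‖x - y‖⁻¹ * ‖f x - f y‖ₑ) ≤
      diffQuotient Ω p r f x * (∫⁻ h : Eucl n, profile r ‖h‖) ^ (1 - 1 / p) := by
  have hm : Measurable fun y : Eucl n => profile r ‖x - y‖ :=
    (measurable_profile hr).comp (measurable_const.sub measurable_id).norm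
  set μ := (volume.restrict Ω).withDensity fun y => profile r ‖x - y‖
  set u : Eucl n → ℝ := fun y => ‖f x - f y‖ / ‖x - y‖
  have hu : AEStronglyMeasurable u (volume.restrict Ω) :=
    ((aestronglyMeasurable_const.sub hf).norm.aemeasurable.div
      (by fun_prop : Measurable fun y => ‖x - y‖).aemeasurable).aestronglyMeasurable
  have hu' : AEStronglyMeasurable u μ := hu.mono_ac (withDensity_absolutelyContinuous _ _)
  have hue : ∀ y, ‖u y‖ₑ = ENNReal.ofReal ‖x - y‖⁻¹ * ‖f x - f y‖ₑ := by
    intro y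
    have h0 : u y = ‖f x - f y‖ / ‖x - y‖ := rfl
    rw [h0, Real.enorm_of_nonneg (by positivity), div_eq_inv_mul, ENNReal.ofReal_mul (by positivity),
      ofReal_norm]
  have h1 : ∫⁻ y in Ω, profile r ‖x - y‖ * (ENNReal.ofReal ‖x - y‖⁻¹ * ‖f x - f y‖ₑ) =
      ∫⁻ y, ‖u y‖ₑ ∂μ := by
    rw [lintegral_withDensity_eq_lintegral_mul₀ hm.aemeasurable hu.enorm]
    simp_rw [Pi.mul_apply, hue]
  have h2 : (∫⁻ y, ‖u y‖ₑ ^ p ∂μ) ^ (1 / p) ≤ diffQuotient Ω p r f x := by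
    rw [lintegral_withDensity_eq_lintegral_mul₀ hm.aemeasurable (hu.enorm.pow_const p),
      diffQuotient]
    refine ENNReal.rpow_le_rpow (lintegral_mono fun y => ?_) (by positivity)
    rw [Pi.mul_apply, profile]
    by_cases hy : 0 < ‖x - y‖
    · rw [indicator_of_mem (mem_Ioi.2 hy), mul_comm, ENNReal.ofReal_mul (by positivity),
        Real.enorm_of_nonneg (by positivity), ENNReal.ofReal_rpow_of_nonneg (by positivity)
        (by linarith), Real.div_rpow (norm_nonneg _) (norm_nonneg _)]
    · rw [indicator_of_notMem (by simpa using hy), zero_mul]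
      exact zero_le
  have h3 : μ univ ≤ ∫⁻ h : Eucl n, profile r ‖h‖ := by
    rw [withDensity_apply _ .univ, Measure.restrict_univ]
    refine (lintegral_mono' Measure.restrict_le_self le_rfl).trans (le_of_eq ?_)
    exact lintegral_sub_left_eq_self (fun h => profile r ‖h‖) x
  have h4 := eLpNorm'_le_eLpNorm'_mul_rpow_measure_univ one_pos hp hu'
  simp only [eLpNorm', ENNReal.rpow_one, div_one] at h4
  rw [h1]
  refine h4.trans (mul_le_mul' h2 (ENNReal.rpow_le_rpow h3 ?_))
  rw [sub_nonneg]
  exact div_le_one_of_le₀ hp (by linarith)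

/-- Hölder's inequality on `Ω`, stated with a strict bound `t` so that an extension of `D` of finite
norm exists. -/
lemma lintegral_enorm_mul_le_of_normOn_lt {X : FunctionNorm n} (hX : IsBallBanachNorm X)
    (hΩ : MeasurableSet Ω) {φ : Eucl n → 𝕜} (hφ : IsTest Ω φ)
    {D : Eucl n → ℝ≥0∞} {t : ℝ≥0∞} (ht : normOn X Ω D < t) :
    ∫⁻ x, ‖φ x‖ₑ * D x ≤ assocNorm X Ω φ * t := by
  simp only [normOn, iInf_lt_iff] at ht
  obtain ⟨d, hd, hdD, hlt⟩ := ht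
  rw [Filter.EventuallyEq, ae_restrict_iff' hΩ] at hdD
  calc ∫⁻ x, ‖φ x‖ₑ * D x = ∫⁻ x, Ω.indicator (fun x => ‖φ x‖ₑ) x * d x := by
        refine lintegral_congr_ae ?_
        filter_upwards [hdD] with x hx
        by_cases hxΩ : x ∈ Ω
        · rw [indicator_of_mem hxΩ, hx hxΩ]
        · have : φ x = 0 := image_eq_zero_of_notMem_tsupport fun h => hxΩ (hφ.subset h)
          simp [this, hxΩ]
    _ ≤ assocNorm X Ω φ * X d := lintegral_mul_le_associate hX _ hd (hlt.trans_le le_top)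
    _ ≤ _ := by gcongr

/-- The distributional derivatives of `f` are bounded functionals on test functions in the norm of
the associate space. -/
theorem enorm_integral_mul_fderiv_le_liminf (hn : 1 ≤ n) {X : FunctionNorm n}
    (hX : IsBallBanachNorm X) (hΩ : IsOpen Ω) {ν₀ : ℝ} (hν₀ : 0 < ν₀) {ρ : ℝ → ℝ → ℝ}
    (hρ : IsRDATI n ν₀ ρ) {p : ℝ} (hp : 1 ≤ p) {f : Eucl n → 𝕜}
    (hf : AEStronglyMeasurable f (volume.restrict Ω)) (hloc : LocallyIntegrableOn f Ω volume)
    {φ : Eucl n → 𝕜} (hφ : IsTest Ω φ) (hφfin : assocNorm X Ω φ < ∞)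
    (hΛ : liminf (fun ν => normOn X Ω (diffQuotient Ω p (ρ ν) f)) (𝓝[>] (0 : ℝ)) < ∞)
    (j : Fin n) :
    ‖∫ x in Ω, f x * fderiv ℝ φ x (EuclideanSpace.single j 1)‖ₑ * (sphereMass n / n) ≤
      assocNorm X Ω φ * sphereMass n ^ (1 - 1 / p) *
        liminf (fun ν => normOn X Ω (diffQuotient Ω p (ρ ν) f)) (𝓝[>] (0 : ℝ)) := by
  have hΩm := hΩ.measurableSet
  obtain ⟨δ, hδ, hδΩ⟩ := hφ.compact.isCompact.exists_cthickening_subset_open hΩ hφ.subset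
  set K := Metric.cthickening δ (tsupport φ)
  have hKc : IsCompact K := hφ.compact.isCompact.cthickening
  have hKm : MeasurableSet K := hKc.measurableSet
  have hφK : tsupport φ ⊆ K := Metric.self_subset_cthickening _
  -- a globally integrable function that agrees with `f` near the support of `φ`
  have hfK : Integrable (K.indicator f) volume :=
    (integrable_indicator_iff hKm).2 (hloc.integrableOn_compact_subset hδΩ hKc)
  set F := hfK.1.mk (K.indicator f)
  have hFm : Measurable F := hfK.1.stronglyMeasurable_mk.measurable
  have hF : Integrable F volume := hfK.congr hfK.1.ae_eq_mk
  have hFf : ∀ᵐ x ∂volume, x ∈ K → F x = f x := by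
    filter_upwards [hfK.1.ae_eq_mk] with x hx hxK
    rw [← indicator_of_mem hxK f, hx]
  have hderiv : ∫ x in Ω, f x * fderiv ℝ φ x (EuclideanSpace.single j 1) =
      ∫ x, F x * fderiv ℝ φ x (EuclideanSpace.single j 1) := by
    rw [← integral_indicator hΩm]
    refine integral_congr_ae ?_
    filter_upwards [hFf] with x hx
    by_cases hxs : x ∈ tsupport φ
    · rw [indicator_of_mem (hφ.subset hxs), hx (hφK hxs)]
    · have h0 : fderiv ℝ φ x = 0 := by
        have := mt (fun h => support_fderiv_subset ℝ h) hxs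
        simpa using this
      by_cases hxΩ : x ∈ Ω <;> simp [hxΩ, h0]
  obtain ⟨M, hM⟩ := hφ.enorm_integral_mul_fderiv_le hF j
  set a := ‖∫ x in Ω, f x * fderiv ℝ φ x (EuclideanSpace.single j 1)‖ₑ with ha
  rw [← hderiv, ← ha] at hM
  -- the kernel is cut off at radius `δ`, so only points `y ∈ K ⊆ Ω` enter the difference quotient
  have hmain : ∀ ν ∈ Ioo 0 ν₀, ∀ t, normOn X Ω (diffQuotient Ω p (ρ ν) f) < t →
      a * (cutMeasure n (ρ ν) δ univ / n) ≤ assocNorm X Ω φ * sphereMass n ^ (1 - 1 / p) * t +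
        M * ∫⁻ h, ‖h‖ₑ ∂(cutMeasure n (ρ ν) δ) := by
    intro ν hν t ht
    have hr := hρ.antitone ν hν
    have hgm : Measurable ((Iio δ).indicator (profile (ρ ν))) :=
      (measurable_profile hr).indicator measurableSet_Iio
    refine (hM _ hgm (ne_top_of_le_ne_top sphereMass_ne_top
      (cutMeasure_univ_le hn hρ hν δ))).trans ?_
    refine add_le_add ?_ le_rfl
    refine (hφ.lintegral_correlation_le hF hFm hgm).trans ?_
    have h1 : ∀ᵐ x ∂volume, ‖φ x‖ₑ * ∫⁻ y, (Iio δ).indicator (profile (ρ ν)) ‖x - y‖ *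
        (ENNReal.ofReal ‖x - y‖⁻¹ * ‖F x - F y‖ₑ) ≤
        (‖φ x‖ₑ * diffQuotient Ω p (ρ ν) f x) * sphereMass n ^ (1 - 1 / p) := by
      filter_upwards [hFf] with x hx
      by_cases hxs : x ∈ tsupport φ
      · rw [mul_assoc]
        gcongr
        rw [← lintegral_profile hn hr (hρ.integral_eq_one ν hν)]
        refine le_trans ?_ (lintegral_profile_le_diffQuotient hf hr hp x)
        rw [← lintegral_indicator hΩm]
        refine lintegral_mono_ae ?_
        filter_upwards [hFf] with y hy
        by_cases hxy : ‖x - y‖ < δ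
        · have hyK : y ∈ K := by
            refine Metric.mem_cthickening_of_dist_le y x δ _ hxs ?_
            rw [dist_comm, dist_eq_norm]
            exact hxy.le
          rw [indicator_of_mem (mem_Iio.2 hxy), indicator_of_mem (hδΩ hyK), hx (hφK hxs), hy hyK]
        · simp [hxy]
      · simp [image_eq_zero_of_notMem_tsupport hxs]
    refine (lintegral_mono_ae h1).trans ?_
    rw [lintegral_mul_const' _ _ (ENNReal.rpow_ne_top_of_nonneg (by
      rw [sub_nonneg]; exact div_le_one_of_le₀ hp (by linarith)) sphereMass_ne_top)]
    rw [mul_right_comm]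
    gcongr
    exact lintegral_enorm_mul_le_of_normOn_lt hX hΩm hφ ht
  have hn0 : (n : ℝ≥0∞) ≠ 0 := by simpa using (by omega : n ≠ 0)
  have hlhs : Tendsto (fun ν => a * (cutMeasure n (ρ ν) δ univ / n)) (𝓝[>] 0)
      (𝓝 (a * (sphereMass n / n))) :=
    ENNReal.Tendsto.const_mul (ENNReal.Tendsto.div_const (tendsto_cutMeasure_univ hn hν₀ hρ hδ)
      (Or.inr hn0)) (Or.inr (by simp [ha]))
  have hSp : sphereMass n ^ (1 - 1 / p) ≠ ∞ := ENNReal.rpow_ne_top_of_nonneg (by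
      rw [sub_nonneg]; exact div_le_one_of_le₀ hp (by linarith)) sphereMass_ne_top
  have hc : assocNorm X Ω φ * sphereMass n ^ (1 - 1 / p) ≠ ∞ := ENNReal.mul_ne_top hφfin.ne hSp
  -- the bound holds for a sequence `ν → 0` along which the norms stay below `t`
  have hstep : ∀ t, liminf (fun ν => normOn X Ω (diffQuotient Ω p (ρ ν) f)) (𝓝[>] (0 : ℝ)) < t →
      a * (sphereMass n / n) ≤ assocNorm X Ω φ * sphereMass n ^ (1 - 1 / p) * t := by
    intro t ht
    have hfreq := frequently_lt_of_liminf_lt (by isBoundedDefault) ht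
    have hrhs : Tendsto (fun ν => assocNorm X Ω φ * sphereMass n ^ (1 - 1 / p) * t +
        M * ∫⁻ h, ‖h‖ₑ ∂(cutMeasure n (ρ ν) δ)) (𝓝[>] 0)
        (𝓝 (assocNorm X Ω φ * sphereMass n ^ (1 - 1 / p) * t + M * 0)) :=
      tendsto_const_nhds.add (ENNReal.Tendsto.const_mul
        (tendsto_lintegral_enorm_cutMeasure hn hν₀ hρ δ) (Or.inr (by simp)))
    rw [mul_zero, add_zero] at hrhs
    refine le_of_tendsto_of_tendsto_of_frequently hlhs hrhs ?_
    exact (hfreq.and_eventually (eventually_mem_Ioo hν₀)).mono fun ν hν => hmain ν hν.2 t hν.1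
  obtain ⟨t, -, ht, htlim⟩ := exists_seq_strictAnti_tendsto' hΛ
  exact ge_of_tendsto' (ENNReal.Tendsto.const_mul htlim (Or.inr hc)) fun k => hstep _ (ht k).1

end

/-! ### The weak gradient -/

section

variable {n : ℕ} {𝕜 : Type*} [RCLike 𝕜] {Ω : Set (Eucl n)} {X : FunctionNorm n}

lemma IsTest.assocNorm_lt_top (hX : IsBallBanachNorm X) {φ : Eucl n → 𝕜} (hφ : IsTest Ω φ) :
    assocNorm X Ω φ < ∞ := by
  obtain ⟨R, hR0, hR⟩ := hφ.compact.isBounded.subset_ball_lt 0 (0 : Eucl n)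
  obtain ⟨B, hB⟩ := hφ.compact.exists_bound_of_continuous hφ.continuous
  have h1 : assocNorm X Ω φ ≤
      associate X (fun x => (B.toNNReal : ℝ≥0∞) * (Metric.ball 0 R).indicator 1 x) := by
    refine associate_mono_ae (Eventually.of_forall fun x => ?_)
    by_cases hx : x ∈ tsupport φ
    · dsimp only
      rw [indicator_of_mem (hφ.subset hx), indicator_of_mem (hR hx), Pi.one_apply, mul_one,
        ← ofReal_norm]
      exact ENNReal.ofReal_le_ofReal (hB x)
    · have : φ x = 0 := image_eq_zero_of_notMem_tsupport hx
      by_cases hxΩ : x ∈ Ω <;> simp [hxΩ, this]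
  rw [associate_const_mul] at h1
  exact h1.trans_lt (ENNReal.mul_lt_top (by simp) (associate_indicator_ball_lt_top hX 0 hR0))

lemma locallyIntegrableOn_of_forall_ball {E : Type*} [NormedAddCommGroup E] {f : Eucl n → E}
    (h : ∀ R : ℝ, IntegrableOn f (Metric.ball 0 R) (volume.restrict Ω)) :
    LocallyIntegrableOn f Ω volume := by
  intro x _
  refine ⟨Metric.ball 0 (‖x‖ + 1) ∩ Ω, ?_, ?_⟩
  · exact inter_mem (mem_nhdsWithin_of_mem_nhds (Metric.isOpen_ball.mem_nhds (by simp)))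
      self_mem_nhdsWithin
  · have := h (‖x‖ + 1)
    rwa [IntegrableOn, Measure.restrict_restrict Metric.isOpen_ball.measurableSet] at this

lemma MemOn.locallyIntegrableOn (hX : IsBallBanachNorm X) {f : Eucl n → 𝕜}
    (hf : MemOn X Ω f) : LocallyIntegrableOn f Ω volume := by
  refine locallyIntegrableOn_of_forall_ball fun R => ⟨hf.1.restrict, ?_⟩
  rcases le_or_gt R 0 with hR | hR
  · simp [Metric.ball_eq_empty.2 hR, HasFiniteIntegral]
  have hlt := hf.2
  simp only [normOn, iInf_lt_iff] at hlt
  obtain ⟨d, hd, hdf, hdlt⟩ := hlt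
  obtain ⟨C, -, hC⟩ := hX.integral_ball 0 R hR
  calc ∫⁻ x in Metric.ball 0 R, ‖f x‖ₑ ∂(volume.restrict Ω)
      = ∫⁻ x in Metric.ball 0 R, d x ∂(volume.restrict Ω) :=
        lintegral_congr_ae (ae_restrict_of_ae hdf.symm)
    _ ≤ ∫⁻ x in Metric.ball 0 R, d x :=
        lintegral_mono' (Measure.restrict_mono_measure Measure.restrict_le_self _) le_rfl
    _ ≤ C * X d := hC d hd hdlt
    _ < ∞ := ENNReal.mul_lt_top (by simp) hdlt

lemma IsTest.integrableOn_mul_fderiv {φ : Eucl n → 𝕜} (hφ : IsTest Ω φ) {f : Eucl n → 𝕜}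
    (hf : LocallyIntegrableOn f Ω volume) (h : Eucl n) :
    IntegrableOn (fun x => f x * fderiv ℝ φ x h) Ω volume := by
  have hK : Integrable ((tsupport φ).indicator f) volume :=
    (integrable_indicator_iff hφ.compact.isCompact.measurableSet).2
      (hf.integrableOn_compact_subset hφ.subset hφ.compact)
  refine ((hφ.integrable_mul_fderiv hK h).congr (Eventually.of_forall fun x => ?_)).integrableOn
  by_cases hx : x ∈ tsupport φ
  · simp [hx]
  · have h0 : fderiv ℝ φ x = 0 := by
      have := mt (fun h => support_fderiv_subset ℝ h) hx
      simpa using this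
    simp [h0]

/-- Partial derivatives exist weakly and belong to `X(Ω)`. -/
theorem exists_weak_partial_derivative (hn : 1 ≤ n) (hX : IsBallBanachNorm X) (hΩ : IsOpen Ω)
    {ν₀ : ℝ} (hν₀ : 0 < ν₀) {ρ : ℝ → ℝ → ℝ} (hρ : IsRDATI n ν₀ ρ) {p : ℝ} (hp : 1 ≤ p)
    (hdense : TestDense 𝕜 (associate X) Ω) (hac : HasACNormOn 𝕜 (associate X) Ω)
    {f : Eucl n → 𝕜} (hf : MemOn X Ω f)
    (hΛ : liminf (fun ν => normOn X Ω (diffQuotient Ω p (ρ ν) f)) (𝓝[>] (0 : ℝ)) < ∞)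
    (j : Fin n) :
    ∃ g : Eucl n → 𝕜, AEStronglyMeasurable g (volume.restrict Ω) ∧
      (∀ R : ℝ, IntegrableOn g (Metric.ball 0 R) (volume.restrict Ω)) ∧
      (∀ φ, IsTest Ω φ → ∫ x in Ω, f x * fderiv ℝ φ x (EuclideanSpace.single j 1) =
        - ∫ x in Ω, g x * φ x) ∧
      normOn X Ω (fun x => ‖g x‖ₑ) ≤ sphereMass n ^ (1 - 1 / p) * (n / sphereMass n) *
        liminf (fun ν => normOn X Ω (diffQuotient Ω p (ρ ν) f)) (𝓝[>] (0 : ℝ)) := by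
  have hloc := hf.locallyIntegrableOn hX
  set Λ := liminf (fun ν => normOn X Ω (diffQuotient Ω p (ρ ν) f)) (𝓝[>] (0 : ℝ)) with hΛd
  have hS0 := sphereMass_ne_zero hn
  have hn0 : (n : ℝ≥0∞) ≠ 0 := by simpa using (by omega : n ≠ 0)
  have hSp : sphereMass n ^ (1 - 1 / p) ≠ ∞ := ENNReal.rpow_ne_top_of_nonneg (by
      rw [sub_nonneg]; exact div_le_one_of_le₀ hp (by linarith)) sphereMass_ne_top
  have hA : sphereMass n ^ (1 - 1 / p) * (n / sphereMass n) * Λ ≠ ∞ :=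
    ENNReal.mul_ne_top (ENNReal.mul_ne_top hSp (ENNReal.div_ne_top (by simp) hS0)) hΛ.ne
  obtain ⟨g, hg, hgl, hgrep, hgn⟩ := exists_representation hX hΩ hdense hac
    (fun φ => - ∫ x in Ω, f x * fderiv ℝ φ x (EuclideanSpace.single j 1))
    (sphereMass n ^ (1 - 1 / p) * (n / sphereMass n) * Λ).toNNReal
    (by
      intro φ ψ hφ hψ
      rw [← neg_add, ← integral_add (hφ.integrableOn_mul_fderiv hloc _)
        (hψ.integrableOn_mul_fderiv hloc _)]
      congr 2 with x
      have := fderiv_add (𝕜 := ℝ) (hφ.smooth.differentiable (by simp) x)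
        (hψ.smooth.differentiable (by simp) x)
      rw [show (fun x => φ x + ψ x) = φ + ψ from rfl, this, add_apply, mul_add])
    (by
      intro c φ hφ
      rw [mul_neg, ← integral_const_mul]
      congr 2 with x
      rw [fderiv_const_mul (hφ.smooth.differentiable (by simp) x), smul_apply,
        smul_eq_mul]
      ring)
    (by
      intro φ hφ
      rw [enorm_neg, ENNReal.coe_toNNReal hA]
      have key := enorm_integral_mul_fderiv_le_liminf hn hX hΩ hν₀ hρ hp hf.1 hloc hφ
        (hφ.assocNorm_lt_top hX) hΛ j
      set a := ‖∫ x in Ω, f x * fderiv ℝ φ x (EuclideanSpace.single j 1)‖ₑ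
      have h1 : sphereMass n / n * (n / sphereMass n) = 1 := by
        rw [← mul_div_assoc, ENNReal.div_mul_cancel hn0 (by simp),
          ENNReal.div_self hS0 sphereMass_ne_top]
      calc a = a * (sphereMass n / n) * (n / sphereMass n) := by rw [mul_assoc, h1, mul_one]
        _ ≤ assocNorm X Ω φ * sphereMass n ^ (1 - 1 / p) * Λ * (n / sphereMass n) := by gcongr
        _ = _ := by ring)
  rw [ENNReal.coe_toNNReal hA] at hgn
  exact ⟨g, hg, hgl, fun φ hφ => by rw [← hgrep φ hφ, neg_neg], hgn⟩

end

end BallBanach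

theorem mainTheorem7 {𝕜 : Type*} [RCLike 𝕜] (n : ℕ) (hn : 1 ≤ n)
    (X : BallBanach.FunctionNorm n) (hX : BallBanach.IsBallBanachNorm X)
    (Ω : Set (BallBanach.Eucl n)) (hΩ : IsOpen Ω)
    (ν₀ : ℝ) (hν₀ : 0 < ν₀) (ρ : ℝ → ℝ → ℝ) (hρ : BallBanach.IsRDATI n ν₀ ρ)
    (p : ℝ) (hp : 1 ≤ p)
    (hdense : BallBanach.TestDense 𝕜 (BallBanach.associate X) Ω)
    (hac : BallBanach.HasACNormOn 𝕜 (BallBanach.associate X) Ω)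
    (β : ℝ) (hβ : 0 < β) (hβn : β < n + 1)
    (hdoubling : BallBanach.IsLocallyDoubling (BallBanach.associate X) β) :
    ∃ C : NNReal, 0 < C ∧ ∀ f : BallBanach.Eucl n → 𝕜, BallBanach.MemOn X Ω f →
      Filter.liminf (fun ν => BallBanach.normOn X Ω (BallBanach.diffQuotient Ω p (ρ ν) f))
        (𝓝[>] (0 : ℝ)) < ∞ →
      ∃ G : BallBanach.Eucl n → EuclideanSpace 𝕜 (Fin n),
        BallBanach.IsWeakGradient Ω f G ∧
        BallBanach.MemOn X Ω (fun x => ‖G x‖) ∧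
        BallBanach.normOn X Ω (fun x => ‖G x‖ₑ) ≤
          C * Filter.liminf
            (fun ν => BallBanach.normOn X Ω (BallBanach.diffQuotient Ω p (ρ ν) f))
            (𝓝[>] (0 : ℝ)) := by
  classical
  set c : ℝ≥0∞ := BallBanach.sphereMass n ^ (1 - 1 / p) * (n / BallBanach.sphereMass n) with hc
  have hΩm := hΩ.measurableSet
  have hctop : c ≠ ∞ := ENNReal.mul_ne_top (ENNReal.rpow_ne_top_of_nonneg (by
      rw [sub_nonneg]; exact div_le_one_of_le₀ hp (by linarith)) BallBanach.sphereMass_ne_top)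
    (ENNReal.div_ne_top (by simp) (BallBanach.sphereMass_ne_zero hn))
  -- `c` bounds each partial derivative and `‖G‖` is at most the sum of their moduli; adding `1`
  -- only serves positivity
  refine ⟨n * c.toNNReal + 1, by positivity, fun f hf hΛ => ?_⟩
  set Λ := Filter.liminf (fun ν => BallBanach.normOn X Ω (BallBanach.diffQuotient Ω p (ρ ν) f))
    (𝓝[>] (0 : ℝ)) with hΛd
  choose g hgm hgl hgw hgn using fun j : Fin n =>
    BallBanach.exists_weak_partial_derivative hn hX hΩ hν₀ hρ hp hdense hac hf hΛ j
  rw [← hc] at hgn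
  set G : BallBanach.Eucl n → EuclideanSpace 𝕜 (Fin n) := fun x => WithLp.toLp 2 fun j => g j x
  have hGm : AEStronglyMeasurable G (volume.restrict Ω) :=
    (PiLp.continuous_toLp 2 _).comp_aestronglyMeasurable
      (aemeasurable_pi_iff.2 fun j => (hgm j).aemeasurable).aestronglyMeasurable
  have hGle : ∀ x, ‖G x‖ ≤ ∑ j, ‖g j x‖ := by
    intro x
    have : G x = ∑ j, EuclideanSpace.single j (g j x) := by
      ext i
      simp [G, Pi.single_apply]
    rw [this]
    refine (norm_sum_le _ _).trans (le_of_eq ?_)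
    simp
  have hbound : BallBanach.normOn X Ω (fun x => ‖G x‖ₑ) ≤ (n * c.toNNReal + 1 : ℝ≥0) * Λ := by
    have hgi : ∀ j, AEMeasurable (Ω.indicator fun x => ‖g j x‖ₑ) volume := fun j =>
      (aemeasurable_indicator_iff hΩm).2 (hgm j).enorm
    rw [hX.normOn_eq hΩm hGm.enorm]
    calc X (Ω.indicator fun x => ‖G x‖ₑ) ≤ X (∑ j, Ω.indicator fun x => ‖g j x‖ₑ) := by
          refine hX.mono _ _ (Finset.aemeasurable_sum _ fun j _ => hgi j)
            ((aemeasurable_indicator_iff hΩm).2 hGm.enorm) (Eventually.of_forall fun x => ?_)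
          rw [Finset.sum_apply]
          by_cases hx : x ∈ Ω
          · simp only [indicator_of_mem hx]
            simp_rw [← ofReal_norm]
            rw [← ENNReal.ofReal_sum_of_nonneg fun j _ => norm_nonneg _]
            exact ENNReal.ofReal_le_ofReal (hGle x)
          · simp [hx]
      _ ≤ ∑ j, X (Ω.indicator fun x => ‖g j x‖ₑ) := hX.sum_le _ hgi
      _ ≤ ∑ j : Fin n, c * Λ := by
          refine Finset.sum_le_sum fun j _ => ?_
          rw [← hX.normOn_eq hΩm (hgm j).enorm]
          exact hgn j
      _ = (n * c) * Λ := by simp [mul_assoc]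
      _ ≤ _ := by
          gcongr
          push_cast
          rw [ENNReal.coe_toNNReal hctop]
          exact le_self_add
  refine ⟨G, ⟨hf.locallyIntegrableOn hX, ?_, fun j φ hφ => hgw j φ hφ⟩, ⟨hGm.norm, ?_⟩, hbound⟩
  · refine BallBanach.locallyIntegrableOn_of_forall_ball fun R => ?_
    exact Integrable.mono' (integrable_finsetSum _ fun j _ => (hgl j R).norm) hGm.restrict
      (Eventually.of_forall hGle)
  · simp only [enorm_norm]
    exact hbound.trans_lt (ENNReal.mul_lt_top ENNReal.coe_lt_top hΛ)
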